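/- Let $n\ge 1$ and $p\in\{0,1,2,\dots\}\cup\{+\infty\}$. Let $D$ be the open unit disc in $\mathbb C$, $D^n\subseteq\mathbb C^n$ the open unit polydisc with topological boundary $\partial D^n$, and $\mathbb T^n\subseteq\partial D^n$ the torus (the product of $n$ unit circles). Let $C^p(\mathbb T^n)$ be the space of functions $f:\mathbb T^n\to\mathbb C$ that are $C^p$ in the angular variables $\theta=(\theta_1,\dots,\theta_n)$, $z_j=e^{i\theta_j}$, with the topology given by the seminorms $|f|_\alpha=\sup_{\mathbb T^n}|\partial^{\alpha}f/\partial\theta^{\alpha}|$, where $\alpha\in\mathbb N^n$ and $|\alpha|\le p$. For an open set $U\subseteq\mathbb C^n$ consider the three sets $$E_1(U)=(U\cap D^n)\cup\mathbb T^n,\qquad E_2(U)=\overline{U\cap D^n},\qquad E_3(U)=(U\cap D^n)\cup\partial D^n .$$ For $k\in\{1,2,3\}$, a function $f:\mathbb T^n\to\mathbb C$ is called holomorphically extendable from one side at $\zeta\in\mathbb T^n$ (with domain of type $k$) if there are an open neighbourhood $U$ of $\zeta$ and a continuous function $F:E_k(U)\to\mathbb C$ that is holomorphic on $U\cap D^n$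 and satisfies $F=f$ on $\mathbb T^n\cap E_k(U)$. It is extendable in the separately continuous sense if, instead of continuity, $F$ is only required to be bounded and separately continuous in its variables on $E_k(U)$, and in the Lipschitz sense if $F$ is required to be Lipschitz continuous on $E_k(U)$. **Theorem.** 1. For $k=2$ and for $k=3$, the set of functions in $C^p(\mathbb T^n)$ that are at no point of $\mathbb T^n$ holomorphically extendable from one side in the separately continuous sense is a dense $G_\delta$ subset of $C^p(\mathbb T^n)$. 2. For each $k\in\{1,2,3\}$, the set of functions in $C^p(\mathbb T^n)$ that are at no point of $\mathbb T^n$ holomorphically extendable from one side (in the usual, continuous sense) is residual in $C^p(\mathbb T^n)$, i.e. it contains a dense $G_\delta$ subset. 3. For each $k\in\{1,2,3\}$, the set of functions in $C^p(\mathbb T^n)$ that are at no point of $\mathbb T^n$ holomorphically extendable from one side in the Lipschitz sense is a dense $G_\delta$ subset of $C^p(\mathbb T^n)$. -/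

import Mathlib

open scoped NNReal

noncomputable section

namespace OneSided

/-! ### The space of `C^p` functions on the torus -/

/-- The `n`-dimensional torus. -/
abbrev Torus (n : ℕ) : Type := Fin n → Circle

/-- The map `θ ↦ (e^{iθ₁}, …, e^{iθₙ})`. -/
def angles {n : ℕ} (θ : Fin n → ℝ) : Torus n := fun i => Circle.exp (θ i)

/-- The partial derivative `∂f/∂θⱼ` of a function on the torus. -/
def angularDeriv {n : ℕ} (j : Fin n) (f : Torus n → ℂ) : Torus n → ℂ := fun z =>
  deriv (fun t : ℝ => f (Function.update z j (z j * Circle.exp t))) 0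

/-- The mixed derivative `∂^α f/∂θ^α = ∂^{|α|} f/∂θ₁^{α₁} ⋯ ∂θₙ^{αₙ}` for a multi-index `α`. -/
def mixedDeriv {n : ℕ} (α : Fin n → ℕ) (f : Torus n → ℂ) : Torus n → ℂ :=
  (List.finRange n).foldr (fun i g => (angularDeriv i)^[α i] g) f

/-- `f` is `C^p` in the angular coordinates. -/
def IsCp {n : ℕ} (p : ℕ∞) (f : Torus n → ℂ) : Prop :=
  ContDiff ℝ (p : WithTop ℕ∞) (fun θ : Fin n → ℝ => f (angles θ))

/-- The complex vector space of `C^p` functions on the torus. -/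
def cpSubmodule (n : ℕ) (p : ℕ∞) : Submodule ℂ (Torus n → ℂ) where
  carrier := {f | IsCp p f}
  add_mem' {f g} (hf : IsCp p f) (hg : IsCp p g) := by
    unfold IsCp at hf hg
    exact hf.add hg
  zero_mem' := by
    change IsCp p 0
    exact contDiff_const
  smul_mem' c f (hf : IsCp p f) := by
    unfold IsCp at hf
    exact contDiff_const.smul hf

/-- The space `C^p(𝕋ⁿ)`. It is a type of its own, so that it carries the topology defined below and
not the topology of pointwise convergence. -/
def CpTorus (n : ℕ) (p : ℕ∞) : Type := cpSubmodule n p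

instance (n : ℕ) (p : ℕ∞) : AddCommGroup (CpTorus n p) :=
  inferInstanceAs (AddCommGroup (cpSubmodule n p))

instance (n : ℕ) (p : ℕ∞) : Module ℂ (CpTorus n p) :=
  inferInstanceAs (Module ℂ (cpSubmodule n p))

/-- The function underlying an element of `C^p(𝕋ⁿ)`. -/
def CpTorus.toFun {n : ℕ} {p : ℕ∞} (f : CpTorus n p) : Torus n → ℂ := f.1

/-! Angular derivatives of smooth functions are linear, continuous and bounded. -/

theorem angles_update_add {n : ℕ} (θ : Fin n → ℝ) (j : Fin n) (t : ℝ) :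
    Function.update (angles θ) j (angles θ j * Circle.exp t) =
      angles (θ + t • Pi.single j (1 : ℝ)) := by
  funext i
  by_cases h : i = j
  · subst h
    simp [angles, Circle.exp_add]
  · simp [angles, h]

theorem angularDeriv_angles {n : ℕ} (j : Fin n) (f : Torus n → ℂ) (θ : Fin n → ℝ) :
    angularDeriv j f (angles θ) =
      lineDeriv ℝ (fun θ' => f (angles θ')) θ (Pi.single j 1) := by
  simp only [angularDeriv, lineDeriv, angles_update_add]

theorem isOpenQuotientMap_angles (n : ℕ) :
    IsOpenQuotientMap (angles : (Fin n → ℝ) → Torus n) := by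
  have h : IsOpenQuotientMap (Circle.exp : ℝ → Circle) :=
    { surjective := fun z => ⟨Complex.arg z, Circle.exp_arg z⟩
      continuous := Circle.exp.continuous
      isOpenMap := isLocalHomeomorph_circleExp.isOpenMap }
  exact IsOpenQuotientMap.piMap fun _ => h

theorem IsCp.angularDeriv {n : ℕ} {m : ℕ} {f : Torus n → ℂ} (j : Fin n)
    (hf : IsCp ((m + 1 : ℕ) : ℕ∞) f) : IsCp (m : ℕ∞) (angularDeriv j f) := by
  unfold IsCp at hf ⊢
  have hd : Differentiable ℝ (fun θ : Fin n → ℝ => f (angles θ)) :=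
    hf.differentiable (by simp)
  have : (fun θ : Fin n → ℝ => OneSided.angularDeriv j f (angles θ)) =
      fun θ => fderiv ℝ (fun θ' => f (angles θ')) θ (Pi.single j 1) := by
    funext θ
    rw [angularDeriv_angles, (hd θ).lineDeriv_eq_fderiv]
  rw [this]
  exact (hf.fderiv_right (m := ((m : ℕ∞) : WithTop ℕ∞)) (by simp)).clm_apply contDiff_const

theorem IsCp.differentiableAt_slice {n : ℕ} {f : Torus n → ℂ} (hf : IsCp 1 f) (j : Fin n)
    (z : Torus n) :
    DifferentiableAt ℝ (fun t : ℝ => f (Function.update z j (z j * Circle.exp t))) 0 := by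
  obtain ⟨θ, rfl⟩ := (isOpenQuotientMap_angles n).surjective z
  simp only [angles_update_add]
  have hd : Differentiable ℝ (fun θ : Fin n → ℝ => f (angles θ)) :=
    ContDiff.differentiable hf (by simp)
  exact (hd.comp (by fun_prop : Differentiable ℝ
    fun t : ℝ => θ + t • (Pi.single j (1 : ℝ) : Fin n → ℝ))).differentiableAt

theorem angularDeriv_add {n : ℕ} {f g : Torus n → ℂ} (hf : IsCp 1 f) (hg : IsCp 1 g)
    (j : Fin n) : angularDeriv j (f + g) = angularDeriv j f + angularDeriv j g := by
  funext z
  exact deriv_add (hf.differentiableAt_slice j z) (hg.differentiableAt_slice j z)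

theorem angularDeriv_smul {n : ℕ} {f : Torus n → ℂ} (hf : IsCp 1 f)
    (j : Fin n) (c : ℂ) : angularDeriv j (c • f) = c • angularDeriv j f := by
  funext z
  exact deriv_const_smul c (hf.differentiableAt_slice j z)

theorem IsCp.of_le {n : ℕ} {p q : ℕ∞} {f : Torus n → ℂ} (hf : IsCp p f) (h : q ≤ p) :
    IsCp q f :=
  ContDiff.of_le hf (by exact_mod_cast h)

theorem IsCp.continuous {n : ℕ} {p : ℕ∞} {f : Torus n → ℂ} (hf : IsCp p f) : Continuous f :=
  (isOpenQuotientMap_angles n).isQuotientMap.continuous_iff.2 (ContDiff.continuous hf)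

theorem IsCp.iterate {n : ℕ} (j : Fin n) (k : ℕ) : ∀ {m : ℕ} {f : Torus n → ℂ},
    IsCp ((m + k : ℕ) : ℕ∞) f → IsCp (m : ℕ∞) ((OneSided.angularDeriv j)^[k] f) := by
  induction k with
  | zero => intro m f hf; exact hf
  | succ k ih => intro m f hf; exact ih (IsCp.angularDeriv j hf)

theorem iterate_add {n : ℕ} (j : Fin n) (k : ℕ) : ∀ {f g : Torus n → ℂ},
    IsCp (k : ℕ∞) f → IsCp (k : ℕ∞) g →
    (angularDeriv j)^[k] (f + g) = (angularDeriv j)^[k] f + (angularDeriv j)^[k] g := by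
  induction k with
  | zero => intro f g _ _; rfl
  | succ k ih =>
    intro f g hf hg
    have h1 : (1 : ℕ∞) ≤ ((k + 1 : ℕ) : ℕ∞) := by simp
    simp only [Function.iterate_succ, Function.comp_apply]
    rw [angularDeriv_add (hf.of_le h1) (hg.of_le h1), ih (hf.angularDeriv j) (hg.angularDeriv j)]

theorem iterate_smul {n : ℕ} (j : Fin n) (c : ℂ) (k : ℕ) : ∀ {f : Torus n → ℂ},
    IsCp (k : ℕ∞) f → (angularDeriv j)^[k] (c • f) = c • (angularDeriv j)^[k] f := by
  induction k with
  | zero => intro f _; rfl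
  | succ k ih =>
    intro f hf
    have h1 : (1 : ℕ∞) ≤ ((k + 1 : ℕ) : ℕ∞) := by simp
    simp only [Function.iterate_succ, Function.comp_apply]
    rw [angularDeriv_smul (hf.of_le h1), ih (hf.angularDeriv j)]

theorem IsCp.foldr {n : ℕ} (α : Fin n → ℕ) (l : List (Fin n)) : ∀ {m : ℕ} {f : Torus n → ℂ},
    IsCp ((m + (l.map α).sum : ℕ) : ℕ∞) f →
    IsCp (m : ℕ∞) (l.foldr (fun i g => (OneSided.angularDeriv i)^[α i] g) f) := by
  induction l with
  | nil => intro m f hf; simpa using hf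
  | cons i l ih =>
    intro m f hf
    refine IsCp.iterate i (α i) (ih ?_)
    simpa [add_assoc] using hf

theorem foldr_add {n : ℕ} (α : Fin n → ℕ) (l : List (Fin n)) {f g : Torus n → ℂ}
    (hf : IsCp (((l.map α).sum : ℕ) : ℕ∞) f) (hg : IsCp (((l.map α).sum : ℕ) : ℕ∞) g) :
    l.foldr (fun i g => (angularDeriv i)^[α i] g) (f + g) =
      l.foldr (fun i g => (angularDeriv i)^[α i] g) f +
      l.foldr (fun i g => (angularDeriv i)^[α i] g) g := by
  induction l with
  | nil => rfl
  | cons i l ih =>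
    have hle : (((l.map α).sum : ℕ) : ℕ∞) ≤ ((((i :: l).map α).sum : ℕ) : ℕ∞) := by
      simp
    simp only [List.foldr_cons]
    rw [ih (hf.of_le hle) (hg.of_le hle), iterate_add i (α i) (IsCp.foldr α l (by simpa using hf))
      (IsCp.foldr α l (by simpa using hg))]

theorem foldr_smul {n : ℕ} (α : Fin n → ℕ) (c : ℂ) (l : List (Fin n)) {f : Torus n → ℂ}
    (hf : IsCp (((l.map α).sum : ℕ) : ℕ∞) f) :
    l.foldr (fun i g => (angularDeriv i)^[α i] g) (c • f) =
      c • l.foldr (fun i g => (angularDeriv i)^[α i] g) f := by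
  induction l with
  | nil => rfl
  | cons i l ih =>
    have hle : (((l.map α).sum : ℕ) : ℕ∞) ≤ ((((i :: l).map α).sum : ℕ) : ℕ∞) := by
      simp
    simp only [List.foldr_cons]
    rw [ih (hf.of_le hle), iterate_smul i c (α i) (IsCp.foldr α l (by simpa using hf))]

theorem sum_map_finRange {n : ℕ} (α : Fin n → ℕ) :
    ((List.finRange n).map α).sum = ∑ i, α i := by
  rw [← List.ofFn_eq_map, List.sum_ofFn]

/-- The multi-indices `α` with `|α| ≤ p`. -/
abbrev MultiIndex (n : ℕ) (p : ℕ∞) : Type := {α : Fin n → ℕ // ((∑ i, α i : ℕ) : ℕ∞) ≤ p}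

instance (n : ℕ) (p : ℕ∞) : Nonempty (MultiIndex n p) := ⟨⟨0, by simp⟩⟩

namespace CpTorus

variable {n : ℕ} {p : ℕ∞}

theorem isCp_sum (f : CpTorus n p) (α : MultiIndex n p) :
    IsCp ((((List.finRange n).map α.1).sum : ℕ) : ℕ∞) f.toFun := by
  have hf : IsCp p f.toFun := f.2
  refine hf.of_le ?_
  rw [sum_map_finRange]
  exact α.2

theorem continuous_mixedDeriv (f : CpTorus n p) (α : MultiIndex n p) :
    Continuous (mixedDeriv α.1 f.toFun) :=
  (IsCp.foldr (m := 0) α.1 (List.finRange n) (by simpa using f.isCp_sum α)).continuous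

theorem bddAbove_mixedDeriv (f : CpTorus n p) (α : MultiIndex n p) :
    BddAbove (Set.range fun z : Torus n => ‖mixedDeriv α.1 f.toFun z‖) :=
  (isCompact_range (f.continuous_mixedDeriv α).norm).bddAbove

/-- The seminorm `|f|_α = sup_{z ∈ 𝕋ⁿ} |∂^α f/∂θ^α (z)|`. -/
def seminorm (n : ℕ) (p : ℕ∞) (α : MultiIndex n p) : Seminorm ℂ (CpTorus n p) :=
  Seminorm.of (fun f => ⨆ z : Torus n, ‖mixedDeriv α.1 f.toFun z‖)
    (fun f g => by
      refine ciSup_le fun z => ?_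
      have h : mixedDeriv α.1 (f + g).toFun =
          mixedDeriv α.1 f.toFun + mixedDeriv α.1 g.toFun :=
        foldr_add α.1 _ (f.isCp_sum α) (g.isCp_sum α)
      rw [h]
      exact (norm_add_le _ _).trans (add_le_add (le_ciSup (f.bddAbove_mixedDeriv α) z)
        (le_ciSup (g.bddAbove_mixedDeriv α) z)))
    (fun c f => by
      have h : mixedDeriv α.1 (c • f).toFun = c • mixedDeriv α.1 f.toFun :=
        foldr_smul α.1 c _ (f.isCp_sum α)
      simp only [h, Pi.smul_apply, norm_smul]
      rw [Real.mul_iSup_of_nonneg (norm_nonneg c)])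

/-- The topology of `C^p(𝕋ⁿ)`, defined by the seminorms `|f|_α`, `|α| ≤ p`. -/
instance : TopologicalSpace (CpTorus n p) :=
  (SeminormFamily.moduleFilterBasis (𝕜 := ℂ) (seminorm n p)).topology

end CpTorus

/-! ### One-sided holomorphic extendability -/

/-- The open unit polydisc `Dⁿ`. -/
def polydisc (n : ℕ) : Set (Fin n → ℂ) := {z | ∀ i, ‖z i‖ < 1}

/-- A point of the torus as a point of `ℂⁿ`. -/
def torusPoint {n : ℕ} (t : Torus n) : Fin n → ℂ := fun i => (t i : ℂ)

/-- The set `[U ∩ Dⁿ] ∪ 𝕋ⁿ`. -/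
def torusDomain {n : ℕ} (U : Set (Fin n → ℂ)) : Set (Fin n → ℂ) :=
  (U ∩ polydisc n) ∪ Set.range torusPoint

/-- The set `[U ∩ Dⁿ] ∪ ∂Dⁿ`. -/
def boundaryDomain {n : ℕ} (U : Set (Fin n → ℂ)) : Set (Fin n → ℂ) :=
  (U ∩ polydisc n) ∪ frontier (polydisc n)

/-- The closure of `U ∩ Dⁿ`. -/
def closedDomain {n : ℕ} (U : Set (Fin n → ℂ)) : Set (Fin n → ℂ) :=
  closure (U ∩ polydisc n)

/-- `F` is bounded on `E` and separately continuous there: at each point of `E` it is continuous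
in each variable, the other variables being fixed. -/
def BoundedSeparatelyContinuousOn {n : ℕ} (F : (Fin n → ℂ) → ℂ) (E : Set (Fin n → ℂ)) : Prop :=
  (∃ M : ℝ, ∀ z ∈ E, ‖F z‖ ≤ M) ∧
    ∀ z ∈ E, ∀ j : Fin n,
      ContinuousWithinAt (fun w : ℂ => F (Function.update z j w))
        {w : ℂ | Function.update z j w ∈ E} (z j)

/-- `F` is Lipschitz continuous on `E`. -/
def IsLipschitzOn {n : ℕ} (F : (Fin n → ℂ) → ℂ) (E : Set (Fin n → ℂ)) : Prop :=
  ∃ K : ℝ≥0, LipschitzOnWith K F E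

/-- `f : 𝕋ⁿ → ℂ` is holomorphically extendable from one side at `ζ ∈ 𝕋ⁿ`: there are an open
neighbourhood `U` of `ζ` and a function `F` on `dom U` that has the regularity `Reg` there, is
holomorphic on `U ∩ Dⁿ` and agrees with `f` at the points of `𝕋ⁿ` in `dom U`. -/
def ExtendableAt {n : ℕ} (dom : Set (Fin n → ℂ) → Set (Fin n → ℂ))
    (Reg : ((Fin n → ℂ) → ℂ) → Set (Fin n → ℂ) → Prop) (f : Torus n → ℂ) (ζ : Torus n) : Prop :=
  ∃ U : Set (Fin n → ℂ), IsOpen U ∧ torusPoint ζ ∈ U ∧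
    ∃ F : (Fin n → ℂ) → ℂ, Reg F (dom U) ∧ DifferentiableOn ℂ F (U ∩ polydisc n) ∧
      ∀ t : Torus n, torusPoint t ∈ dom U → F (torusPoint t) = f t

/-- The functions in `C^p(𝕋ⁿ)` that are extendable at no point of `𝕋ⁿ`. -/
def nowhereExtendable (n : ℕ) (p : ℕ∞) (dom : Set (Fin n → ℂ) → Set (Fin n → ℂ))
    (Reg : ((Fin n → ℂ) → ℂ) → Set (Fin n → ℂ) → Prop) : Set (CpTorus n p) :=
  {f | ∀ ζ : Torus n, ¬ ExtendableAt dom Reg f.toFun ζ}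

end OneSided

end

namespace OneSided

open Set Filter Topology Metric ComplexConjugate

/-! ### Caps of the unit disc and the two constants estimate -/

/-! Everything is tested on caps, the pieces that chords cut off the disc, and on products of caps.
The obstruction to extension is the smooth function `h(t) = ∑ t^{-2^k} / k!`. Its frequencies are
negative, and its coefficients decay faster than any power of `2^k` but far more slowly than
`e^{-2^k b}`. By `lacunary_not_capApproximable`, `h` is not a limit, uniform on an arc, of boundary
values of functions holomorphic on the cap with a common bound. The tool is the two constants
estimate: a function bounded by `M` on a cap and by `ε` on its arc is at most `√(M ε)` on the half
cap.

Density needs no Baire argument. On a given curve and cap, at most one real `s` makes `f + s h`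
approximable with some bound, since two such values would make `h` approximable
(`dense_nowhereApproximable`). Countably many curves and caps thus exclude countably many `s`. A
continuous extension restricts to the disc through a torus point along the diagonal, which meets the
closed polydisc only in the open polydisc and the torus, so the argument serves all three domains. A
separately continuous one is restricted to a coordinate slice instead.

For the `G_δ` property, extendability is written as a countable union over centres or basis sets,
radii and bounds. In the Lipschitz case each piece is closed, by a Montel argument with
ultrafilters. In the separately continuous case the two constants estimate in `n` variables shows
that a limit of functions extendable to a polycap is extendable to the half polycap
(`closure_polycapExtendable_subset`). A cutoff then turns this into an extension to the whole
domain. -/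

/-- The closed cap `{w ∈ closed disc : Re (w c̄) ≥ 1 - r}`. -/
def closedCap (c : ℂ) (r : ℝ) : Set ℂ := {w | ‖w‖ ≤ 1 ∧ 1 - r ≤ (w * conj c).re}

/-- The open cap `{w ∈ open disc : Re (w c̄) > 1 - r}`. -/
def openCap (c : ℂ) (r : ℝ) : Set ℂ := {w | ‖w‖ < 1 ∧ 1 - r < (w * conj c).re}

theorem openCap_subset_closedCap (c : ℂ) (r : ℝ) : openCap c r ⊆ closedCap c r :=
  fun _ h => ⟨h.1.le, h.2.le⟩

theorem closedCap_mono (c : ℂ) {r s : ℝ} (h : r ≤ s) : closedCap c r ⊆ closedCap c s :=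
  fun _ hw => ⟨hw.1, by linarith [hw.2]⟩

theorem openCap_mono (c : ℂ) {r s : ℝ} (h : r ≤ s) : openCap c r ⊆ openCap c s :=
  fun _ hw => ⟨hw.1, by linarith [hw.2]⟩

theorem isClosed_closedCap (c : ℂ) (r : ℝ) : IsClosed (closedCap c r) :=
  (isClosed_le continuous_norm continuous_const).inter
    (isClosed_le continuous_const (by fun_prop : Continuous fun w : ℂ => (w * conj c).re))

theorem isOpen_openCap (c : ℂ) (r : ℝ) : IsOpen (openCap c r) :=
  (isOpen_lt continuous_norm continuous_const).inter
    (isOpen_lt continuous_const (by fun_prop : Continuous fun w : ℂ => (w * conj c).re))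

theorem isCompact_closedCap (c : ℂ) (r : ℝ) : IsCompact (closedCap c r) :=
  (isCompact_closedBall (0 : ℂ) 1).of_isClosed_subset (isClosed_closedCap c r)
    fun w hw => by simpa using hw.1

theorem mul_conj_self {c : ℂ} (hc : ‖c‖ = 1) : c * conj c = 1 := by
  rw [Complex.mul_conj, Complex.normSq_eq_norm_sq, hc]; simp

theorem self_mem_closedCap {c : ℂ} (hc : ‖c‖ = 1) {r : ℝ} (hr : 0 < r) : c ∈ closedCap c r := by
  refine ⟨hc.le, ?_⟩
  rw [mul_conj_self hc]
  simpa using hr.le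

theorem norm_sub_sq_le_of_mem_closedCap {c w : ℂ} (hc : ‖c‖ = 1) {r : ℝ}
    (hw : w ∈ closedCap c r) : ‖w - c‖ ^ 2 ≤ 2 * r := by
  have h1 : ‖w‖ ^ 2 ≤ 1 := by nlinarith [hw.1, norm_nonneg w]
  have h2 := hw.2
  have h3 : ‖w - c‖ ^ 2 = ‖w‖ ^ 2 + ‖c‖ ^ 2 - 2 * (w * conj c).re := by
    rw [← Complex.normSq_eq_norm_sq, ← Complex.normSq_eq_norm_sq, ← Complex.normSq_eq_norm_sq,
      Complex.normSq_sub]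
  rw [h3, hc]
  linarith

/-- Caps at `c` shrink to `c`, so they can serve as a neighbourhood basis in the closed disc. -/
theorem closedCap_subset_ball {c : ℂ} (hc : ‖c‖ = 1) {r δ : ℝ} (hδ : 0 < δ) (h : 2 * r < δ ^ 2) :
    closedCap c r ⊆ ball c δ := fun w hw => by
  rw [mem_ball, dist_eq_norm]
  exact lt_of_pow_lt_pow_left₀ 2 hδ.le ((norm_sub_sq_le_of_mem_closedCap hc hw).trans_lt h)

/-- The segment from an interior point of a cap to a point of the closed cap. -/
theorem segment_mem_openCap {c w : ℂ} (hc : ‖c‖ = 1) {r : ℝ} (hr : 0 < r) (hr1 : r ≤ 1)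
    (hw : w ∈ closedCap c r) {s : ℝ} (hs : 0 < s) (hs1 : s ≤ 1) :
    ((1 - s : ℝ) : ℂ) * w + ((s * (1 - r / 2) : ℝ) : ℂ) * c ∈ openCap c r := by
  constructor
  · refine (norm_add_le _ _).trans_lt ?_
    rw [norm_mul, norm_mul, hc, Complex.norm_real, Complex.norm_real, Real.norm_of_nonneg
      (by linarith), Real.norm_of_nonneg (mul_nonneg hs.le (by linarith))]
    nlinarith [hw.1, norm_nonneg w, mul_pos hs hr]
  · have : (((1 - s : ℝ) : ℂ) * w + ((s * (1 - r / 2) : ℝ) : ℂ) * c) * conj c =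
        ((1 - s : ℝ) : ℂ) * (w * conj c) + ((s * (1 - r / 2) : ℝ) : ℂ) * 1 := by
      rw [← mul_conj_self hc]; ring
    rw [this, Complex.add_re, Complex.re_ofReal_mul, Complex.re_ofReal_mul, Complex.one_re]
    nlinarith [hw.2, mul_pos hs hr]

theorem tendsto_segment (c w : ℂ) (r : ℝ) :
    Tendsto (fun k : ℕ => ((1 - 1 / ((k : ℝ) + 1) : ℝ) : ℂ) * w +
      ((1 / ((k : ℝ) + 1) * (1 - r / 2) : ℝ) : ℂ) * c) atTop (𝓝 w) := by
  have h : Tendsto (fun s : ℝ => ((1 - s : ℝ) : ℂ) * w + ((s * (1 - r / 2) : ℝ) : ℂ) * c)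
      (𝓝 0) (𝓝 (((1 - 0 : ℝ) : ℂ) * w + ((0 * (1 - r / 2) : ℝ) : ℂ) * c)) := by
    refine Continuous.tendsto ?_ 0
    fun_prop
  simpa [Function.comp_def] using h.comp tendsto_one_div_add_atTop_nhds_zero_nat

theorem exists_seq_openCap {c w : ℂ} (hc : ‖c‖ = 1) {r : ℝ} (hr : 0 < r) (hr1 : r ≤ 1)
    (hw : w ∈ closedCap c r) :
    ∃ u : ℕ → ℂ, (∀ k, u k ∈ openCap c r) ∧ Tendsto u atTop (𝓝 w) := by
  refine ⟨_, fun k => segment_mem_openCap hc hr hr1 hw (s := 1 / ((k : ℝ) + 1)) (by positivity) ?_,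
    tendsto_segment c w r⟩
  rw [div_le_one (by positivity)]
  linarith [(Nat.cast_nonneg k : (0 : ℝ) ≤ k)]

theorem closure_openCap {c : ℂ} (hc : ‖c‖ = 1) {r : ℝ} (hr : 0 < r) (hr1 : r ≤ 1) :
    closure (openCap c r) = closedCap c r := by
  refine Subset.antisymm
    (closure_minimal (openCap_subset_closedCap c r) (isClosed_closedCap c r)) fun w hw => ?_
  obtain ⟨u, hu, hlim⟩ := exists_seq_openCap hc hr hr1 hw
  exact mem_closure_of_tendsto hlim (Eventually.of_forall hu)

/-- A two constants estimate on a cap. -/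
theorem two_constants {c : ℂ} (hc : ‖c‖ = 1) {r : ℝ} (hr : 0 < r) (hr1 : r ≤ 1) {g : ℂ → ℂ}
    (hg : ContinuousOn g (closedCap c r)) (hd : DifferentiableOn ℂ g (openCap c r))
    {M ε : ℝ} (hε : 0 < ε) (hM : ∀ w ∈ closedCap c r, ‖g w‖ ≤ M)
    (harc : ∀ w ∈ closedCap c r, ‖w‖ = 1 → ‖g w‖ ≤ ε)
    {w : ℂ} (hw : w ∈ closedCap c (r / 2)) : ‖g w‖ ≤ √(M * ε) := by
  have hwr : w ∈ closedCap c r := closedCap_mono c (by linarith) hw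
  rcases le_or_gt M ε with hle | hlt
  · refine Real.le_sqrt_of_sq_le ?_
    have := hM w hwr
    nlinarith [norm_nonneg (g w)]
  have hM0 : 0 < M := hε.trans hlt
  set L := Real.log (M / ε) with hL
  have hL0 : 0 ≤ L := Real.log_nonneg ((one_le_div hε).2 hlt.le)
  have hexpL : Real.exp L = M / ε := Real.exp_log (div_pos hM0 hε)
  -- The exponential has modulus `1` on the chord and at most `M / ε` on the arc, so `M` bounds the
  -- product on the whole boundary. On the half cap the modulus is at least `√(M / ε)`, which is the
  -- gain.
  set h : ℂ → ℂ := fun z => g z * Complex.exp (((L / r : ℝ) : ℂ) * (z * conj c - ((1 - r : ℝ) : ℂ)))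
    with hh
  have hnorm (z : ℂ) : ‖h z‖ = ‖g z‖ * Real.exp (L / r * ((z * conj c).re - (1 - r))) := by
    simp only [hh, norm_mul, Complex.norm_exp]
    rw [Complex.re_ofReal_mul, Complex.sub_re, Complex.ofReal_re]
  have hmax : ‖h w‖ ≤ M := by
    refine Complex.norm_le_of_forall_mem_frontier_norm_le (U := openCap c r) ?_ ⟨?_, ?_⟩ ?_
      (by rwa [closure_openCap hc hr hr1])
    · exact (isCompact_closedCap c r).isBounded.subset (openCap_subset_closedCap c r)
    · exact hd.mul (by fun_prop)
    · rw [closure_openCap hc hr hr1]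
      exact hg.mul (by fun_prop)
    · intro z hz
      rw [frontier, closure_openCap hc hr hr1, (isOpen_openCap c r).interior_eq] at hz
      obtain ⟨hz, hz'⟩ := hz
      rw [hnorm]
      rcases hz.1.eq_or_lt with h1 | h1
      · have hre : (z * conj c).re ≤ 1 := by
          refine (Complex.re_le_norm _).trans ?_
          rw [norm_mul, h1, RCLike.norm_conj, hc, one_mul]
        calc ‖g z‖ * Real.exp (L / r * ((z * conj c).re - (1 - r)))
            ≤ ε * Real.exp L := by
              refine mul_le_mul (harc z hz h1) (Real.exp_le_exp.2 ?_) (Real.exp_nonneg _) hε.le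
              calc L / r * ((z * conj c).re - (1 - r)) ≤ L / r * r := by
                    refine mul_le_mul_of_nonneg_left (by linarith) (by positivity)
                _ = L := by field_simp
          _ = M := by rw [hexpL]; field_simp
      · have h2 : (z * conj c).re = 1 - r :=
          le_antisymm (not_lt.1 fun h => hz' ⟨h1, h⟩) hz.2
        rw [h2, sub_self, mul_zero, Real.exp_zero, mul_one]
        exact hM z hz
  rw [hnorm] at hmax
  have hlow : √(M / ε) ≤ Real.exp (L / r * ((w * conj c).re - (1 - r))) := by
    rw [← hexpL, ← Real.exp_half, Real.exp_le_exp]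
    calc L / 2 = L / r * (r / 2) := by field_simp
      _ ≤ _ := mul_le_mul_of_nonneg_left (by linarith [hw.2]) (by positivity)
  have hs : 0 < √(M / ε) := Real.sqrt_pos.2 (by positivity)
  have h3 : ‖g w‖ * √(M / ε) ≤ M := (mul_le_mul_of_nonneg_left hlow (norm_nonneg _)).trans hmax
  have h4 : √(M * ε) * √(M / ε) = M := by
    rw [← Real.sqrt_mul (by positivity)]
    rw [show M * ε * (M / ε) = M ^ 2 by field_simp]
    exact Real.sqrt_sq hM0.le
  exact le_of_mul_le_mul_right (h3.trans h4.ge) hs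

/-! ### Pointwise limits of bounded families of holomorphic functions -/

section MontelLimit

variable {E : Type*} [NormedAddCommGroup E] [NormedSpace ℂ E]

/-- Schwarz lemma: the values stay within `2 C` of `φ z`. -/
theorem norm_fderiv_le_of_bounded {φ : E → ℂ} {z : E} {ρ C : ℝ} (hρ : 0 < ρ)
    (hd : DifferentiableOn ℂ φ (ball z ρ)) (hC : ∀ x ∈ ball z ρ, ‖φ x‖ ≤ C) :
    ‖fderiv ℂ φ z‖ ≤ 2 * C / ρ := by
  refine Complex.norm_fderiv_le_div_of_mapsTo_ball hd (fun x hx => ?_) hρ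
  rw [mem_closedBall, dist_eq_norm]
  linarith [norm_sub_le (φ x) (φ z), hC x hx, hC z (mem_ball_self hρ)]

/-- A holomorphic function bounded on a ball is approximated to second order by its derivative at
the center, with a constant that depends only on the bound and the radius. -/
theorem norm_sub_fderiv_le_of_bounded {φ : E → ℂ} {z : E} {ρ C : ℝ} (hρ : 0 < ρ)
    (hd : DifferentiableOn ℂ φ (ball z ρ)) (hC : ∀ x ∈ ball z ρ, ‖φ x‖ ≤ C) {x : E}
    (hx : x ∈ ball z ρ) :
    ‖φ x - φ z - fderiv ℂ φ z (x - z)‖ ≤ 4 * C / ρ ^ 2 * ‖x - z‖ ^ 2 := by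
  have hda : DifferentiableAt ℂ φ z := hd.differentiableAt (ball_mem_nhds z hρ)
  set ψ : E → ℂ := fun y => φ y - fderiv ℂ φ z (y - z) with hψ
  have hψz : ψ z = φ z := by simp [hψ]
  have hD := norm_fderiv_le_of_bounded hρ hd hC
  -- Removing the linear part leaves a function that vanishes to second order and moves by at most
  -- `2 C + 2 C`, so the Schwarz lemma of order two applies.
  have key : dist (ψ x) (ψ z) ≤ 4 * C * (dist x z / ρ) ^ (1 + 1) := by
    refine Complex.dist_le_mul_div_pow_of_mapsTo_ball_of_isLittleO ?_ (fun y hy => ?_) ?_ hx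
    · exact hd.sub ((fderiv ℂ φ z).differentiable.comp_differentiableOn
        (differentiableOn_id.sub_const z))
    · rw [mem_closedBall, dist_eq_norm, hψz]
      have h1 : ‖fderiv ℂ φ z (y - z)‖ ≤ 2 * C := by
        refine ((fderiv ℂ φ z).le_opNorm _).trans ?_
        have h2 : ‖y - z‖ ≤ ρ := by simpa [dist_eq_norm] using (mem_ball.1 hy).le
        calc ‖fderiv ℂ φ z‖ * ‖y - z‖ ≤ 2 * C / ρ * ρ :=
              mul_le_mul hD h2 (norm_nonneg _) ((norm_nonneg _).trans hD)
          _ = 2 * C := by field_simp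
      have h3 : ψ y - φ z = φ y - φ z - fderiv ℂ φ z (y - z) := by simp only [hψ]; ring
      rw [h3]
      linarith [norm_sub_le (φ y - φ z) (fderiv ℂ φ z (y - z)), norm_sub_le (φ y) (φ z), hC y hy,
        hC z (mem_ball_self hρ)]
    · have := hda.hasFDerivAt.isLittleO
      simp only [pow_one]
      rw [hψz]
      refine (this.norm_right).congr_left fun y => ?_
      simp only [hψ]; ring
  rw [dist_eq_norm, dist_eq_norm, hψz] at key
  have h3 : ψ x - φ z = φ x - φ z - fderiv ℂ φ z (x - z) := by simp only [hψ]; ring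
  rw [h3] at key
  refine key.trans (le_of_eq ?_)
  rw [div_pow]
  ring

/-- The pointwise limit along an ultrafilter of a locally bounded family of holomorphic functions
is holomorphic. -/
theorem differentiableOn_of_tendsto_ultrafilter [FiniteDimensional ℂ E] {ι : Type*}
    (l : Ultrafilter ι) {F : ι → E → ℂ} {G : E → ℂ} {Ω : Set E} (hΩ : IsOpen Ω) {C : ℝ}
    (hd : ∀ i, DifferentiableOn ℂ (F i) Ω) (hC : ∀ i, ∀ z ∈ Ω, ‖F i z‖ ≤ C)
    (hlim : ∀ z ∈ Ω, Tendsto (fun i => F i z) l (𝓝 (G z))) : DifferentiableOn ℂ G Ω := by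
  intro z hz
  obtain ⟨ρ, hρ, hball⟩ := Metric.isOpen_iff.1 hΩ z hz
  have hd' (i : ι) := (hd i).mono hball
  have hC' (i : ι) : ∀ x ∈ ball z ρ, ‖F i x‖ ≤ C := fun x hx => hC i x (hball hx)
  have : ProperSpace (E →L[ℂ] ℂ) := FiniteDimensional.proper ℂ _
  -- The derivatives at `z` lie in a compact ball, so they converge along the ultrafilter. The
  -- quadratic error bound is uniform in `i` and passes to the limit, which makes `A` the derivative
  -- of `G`.
  obtain ⟨A, -, hA⟩ := (isCompact_closedBall (0 : E →L[ℂ] ℂ) (2 * C / ρ)).ultrafilter_le_nhds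
    (l.map fun i => fderiv ℂ (F i) z) (by
      rw [Ultrafilter.coe_map, le_principal_iff]
      exact mem_map.2 <| Eventually.of_forall fun i => by
        simpa using norm_fderiv_le_of_bounded hρ (hd' i) (hC' i))
  have hA' : Tendsto (fun i => fderiv ℂ (F i) z) l (𝓝 A) := hA
  have hquad : ∀ x ∈ ball z ρ, ‖G x - G z - A (x - z)‖ ≤ 4 * C / ρ ^ 2 * ‖x - z‖ ^ 2 := by
    intro x hx
    refine le_of_tendsto (x := (l : Filter ι)) (((hlim x (hball hx)).sub (hlim z hz)).sub
      (((ContinuousLinearMap.apply ℂ ℂ (x - z)).continuous.tendsto A).comp hA')).norm (Eventually.of_forall fun i => ?_)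
    exact norm_sub_fderiv_le_of_bounded hρ (hd' i) (hC' i) hx
  refine HasFDerivAt.differentiableAt (f' := A) ?_ |>.differentiableWithinAt
  rw [hasFDerivAt_iff_isLittleO]
  have h1 : (fun x => G x - G z - A (x - z)) =O[𝓝 z] fun x => ‖x - z‖ ^ 2 := by
    refine Asymptotics.IsBigO.of_bound (4 * C / ρ ^ 2) ?_
    filter_upwards [ball_mem_nhds z hρ] with x hx
    simpa using hquad x hx
  refine h1.trans_isLittleO ?_
  have h2 : Tendsto (fun x : E => x - z) (𝓝 z) (𝓝 0) := by
    simpa using (continuous_id.sub continuous_const).tendsto (f := fun x : E => x - z) z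
  have h3 : (fun x : E => ‖x‖ ^ 2) =o[𝓝 0] fun x => x := by
    have := Asymptotics.isLittleO_norm_pow_id (E' := E) (n := 2) (by norm_num)
    exact this
  exact h3.comp_tendsto h2

/-- The pointwise limit of a bounded sequence of holomorphic functions is holomorphic. -/
theorem differentiableOn_of_tendsto [FiniteDimensional ℂ E] {F : ℕ → E → ℂ} {G : E → ℂ}
    {Ω : Set E} (hΩ : IsOpen Ω) {C : ℝ} (hd : ∀ i, DifferentiableOn ℂ (F i) Ω)
    (hC : ∀ i, ∀ z ∈ Ω, ‖F i z‖ ≤ C)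
    (hlim : ∀ z ∈ Ω, Tendsto (fun i => F i z) atTop (𝓝 (G z))) : DifferentiableOn ℂ G Ω :=
  differentiableOn_of_tendsto_ultrafilter (Ultrafilter.of atTop) hΩ hd hC
    fun z hz => (hlim z hz).mono_left (Ultrafilter.of_le _)

end MontelLimit

/-! ### Separately continuous functions on products of caps -/

/-- A product of closed caps. -/
def closedPolycap {n : ℕ} (ζ : Fin n → ℂ) (r : ℝ) : Set (Fin n → ℂ) :=
  {z | ∀ i, z i ∈ closedCap (ζ i) r}

/-- A product of open caps. -/
def openPolycap {n : ℕ} (ζ : Fin n → ℂ) (r : ℝ) : Set (Fin n → ℂ) :=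
  {z | ∀ i, z i ∈ openCap (ζ i) r}

/-- `F` is bounded by `M` and separately continuous on a closed polycap, and holomorphic on the open
polycap. -/
structure HolomorphicOnPolycap {n : ℕ} (F : (Fin n → ℂ) → ℂ) (ζ : Fin n → ℂ) (r M : ℝ) : Prop where
  norm_le : ∀ z ∈ closedPolycap ζ r, ‖F z‖ ≤ M
  continuousOn_slice : ∀ z ∈ closedPolycap ζ r, ∀ j,
    ContinuousOn (fun w => F (Function.update z j w)) (closedCap (ζ j) r)
  differentiableOn : DifferentiableOn ℂ F (openPolycap ζ r)

section Polycap

variable {n : ℕ} {ζ : Fin n → ℂ} {r : ℝ}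

theorem openPolycap_subset_closedPolycap (ζ : Fin n → ℂ) (r : ℝ) :
    openPolycap ζ r ⊆ closedPolycap ζ r :=
  fun _ h i => openCap_subset_closedCap _ _ (h i)

theorem closedPolycap_mono (ζ : Fin n → ℂ) {r s : ℝ} (h : r ≤ s) :
    closedPolycap ζ r ⊆ closedPolycap ζ s :=
  fun _ hz i => closedCap_mono _ h (hz i)

theorem openPolycap_mono (ζ : Fin n → ℂ) {r s : ℝ} (h : r ≤ s) :
    openPolycap ζ r ⊆ openPolycap ζ s :=
  fun _ hz i => openCap_mono _ h (hz i)

theorem isOpen_openPolycap (ζ : Fin n → ℂ) (r : ℝ) : IsOpen (openPolycap ζ r) := by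
  have : openPolycap ζ r = ⋂ i, (fun z : Fin n → ℂ => z i) ⁻¹' openCap (ζ i) r := by
    ext z; simp [openPolycap]
  rw [this]
  exact isOpen_iInter_of_finite fun i => (isOpen_openCap _ _).preimage (continuous_apply i)

theorem update_mem_closedPolycap {z : Fin n → ℂ} (hz : z ∈ closedPolycap ζ r) {j : Fin n} {w : ℂ}
    (hw : w ∈ closedCap (ζ j) r) : Function.update z j w ∈ closedPolycap ζ r := fun i => by
  rcases eq_or_ne i j with rfl | h
  · simpa using hw
  · simpa [h] using hz i

theorem HolomorphicOnPolycap.mono {F : (Fin n → ℂ) → ℂ} {M s M' : ℝ}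
    (hF : HolomorphicOnPolycap F ζ r M) (hs : s ≤ r) (hM : M ≤ M') :
    HolomorphicOnPolycap F ζ s M' where
  norm_le z hz := (hF.norm_le z (closedPolycap_mono ζ hs hz)).trans hM
  continuousOn_slice z hz j :=
    (hF.continuousOn_slice z (closedPolycap_mono ζ hs hz) j).mono (closedCap_mono _ hs)
  differentiableOn := hF.differentiableOn.mono (openPolycap_mono ζ hs)

theorem HolomorphicOnPolycap.sub {F G : (Fin n → ℂ) → ℂ} {M M' : ℝ}
    (hF : HolomorphicOnPolycap F ζ r M) (hG : HolomorphicOnPolycap G ζ r M') :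
    HolomorphicOnPolycap (fun z => F z - G z) ζ r (M + M') where
  norm_le z hz := (norm_sub_le _ _).trans (add_le_add (hF.norm_le z hz) (hG.norm_le z hz))
  continuousOn_slice z hz j := (hF.continuousOn_slice z hz j).sub (hG.continuousOn_slice z hz j)
  differentiableOn := hF.differentiableOn.sub hG.differentiableOn

/-- Holomorphy in one variable persists when the others lie on the boundary of their caps. The
induction frees one coordinate at a time: it is approached from the open cap, separate continuity
gives pointwise convergence of the slices, and `M` bounds them all. -/
theorem HolomorphicOnPolycap.differentiableOn_slice {F : (Fin n → ℂ) → ℂ} {M : ℝ}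
    (hζ : ∀ i, ‖ζ i‖ = 1) (hr : 0 < r) (hr1 : r ≤ 1) (hF : HolomorphicOnPolycap F ζ r M)
    {z : Fin n → ℂ} (hz : z ∈ closedPolycap ζ r) (j : Fin n) :
    DifferentiableOn ℂ (fun w => F (Function.update z j w)) (openCap (ζ j) r) := by
  suffices H : ∀ s : Finset (Fin n), ∀ z ∈ closedPolycap ζ r,
      (∀ i, i ∉ s → i ≠ j → z i ∈ openCap (ζ i) r) →
      DifferentiableOn ℂ (fun w => F (Function.update z j w)) (openCap (ζ j) r) from
    H Finset.univ z hz (by simp)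
  intro s
  induction s using Finset.induction_on with
  | empty =>
    intro z _ hopen
    refine hF.differentiableOn.comp
      (fun w _ => (hasFDerivAt_update z w).differentiableAt.differentiableWithinAt) fun w hw i => ?_
    rcases eq_or_ne i j with rfl | h
    · simpa using hw
    · simpa [h] using hopen i (by simp) h
  | insert a s _ ih =>
    intro z hz hopen
    rcases eq_or_ne a j with rfl | haj
    · exact ih z hz fun i hi hij => hopen i (by simp [hi, hij]) hij
    obtain ⟨u, hu, hlim⟩ := exists_seq_openCap (hζ a) hr hr1 (hz a)
    refine differentiableOn_of_tendsto (F := fun k w => F (Function.update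
      (Function.update z a (u k)) j w)) (C := M) (isOpen_openCap _ _) (fun k => ?_)
      (fun k w hw => ?_) fun w hw => ?_
    · refine ih _ (update_mem_closedPolycap hz (openCap_subset_closedCap _ _ (hu k)))
        fun i hi hij => ?_
      rcases eq_or_ne i a with rfl | hia
      · simpa using hu k
      · simpa [hia] using hopen i (by simp [hi, hia]) hij
    · exact hF.norm_le _ (update_mem_closedPolycap (update_mem_closedPolycap hz
        (openCap_subset_closedCap _ _ (hu k))) (openCap_subset_closedCap _ _ hw))
    · simp only [Function.update_comm haj]
      have hzw := update_mem_closedPolycap hz (openCap_subset_closedCap _ _ hw)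
      have hc := hF.continuousOn_slice _ hzw a (z a) (hz a)
      have h2 : Function.update (Function.update z j w) a (z a) = Function.update z j w := by
        rw [Function.update_comm haj.symm, Function.update_eq_self]
      have h3 := hc.tendsto.comp (tendsto_nhdsWithin_iff.2
        ⟨hlim, Eventually.of_forall fun k => openCap_subset_closedCap _ _ (hu k)⟩)
      rwa [h2] at h3

/-- The bound in the two constants estimate in `n` variables. -/
noncomputable def twoConstantsBound (n : ℕ) (M ε : ℝ) : ℝ := (fun x => √(M * x))^[n] ε

theorem twoConstantsBound_succ (n : ℕ) (M ε : ℝ) :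
    twoConstantsBound (n + 1) M ε = √(M * twoConstantsBound n M ε) :=
  Function.iterate_succ_apply' _ _ _

theorem twoConstantsBound_pos (n : ℕ) {M ε : ℝ} (hM : 0 < M) (hε : 0 < ε) :
    0 < twoConstantsBound n M ε := by
  induction n with
  | zero => exact hε
  | succ n ih =>
    rw [twoConstantsBound_succ]
    exact Real.sqrt_pos.2 (mul_pos hM ih)

theorem tendsto_twoConstantsBound (n : ℕ) (M : ℝ) :
    Tendsto (twoConstantsBound n M) (𝓝 0) (𝓝 0) := by
  have hc : Continuous (twoConstantsBound n M) :=
    Continuous.iterate (by fun_prop : Continuous fun x => √(M * x)) n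
  have h0 : twoConstantsBound n M 0 = 0 := Function.iterate_fixed (by simp) n
  simpa [h0] using hc.tendsto 0

/-- The two constants estimate in several variables. -/
theorem HolomorphicOnPolycap.norm_le_twoConstantsBound {F : (Fin n → ℂ) → ℂ} {M ε : ℝ}
    (hζ : ∀ i, ‖ζ i‖ = 1) (hr : 0 < r) (hr1 : r ≤ 1) (hF : HolomorphicOnPolycap F ζ r M)
    (hM : 0 < M) (hε : 0 < ε)
    (htorus : ∀ z ∈ closedPolycap ζ r, (∀ i, ‖z i‖ = 1) → ‖F z‖ ≤ ε)
    {z : Fin n → ℂ} (hz : z ∈ closedPolycap ζ (r / 2)) :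
    ‖F z‖ ≤ twoConstantsBound n M ε := by
  -- Here `s` holds the coordinates that have left the circle. Each new one costs one use of
  -- `two_constants`, with the previous bound as the value on the arc.
  suffices H : ∀ s : Finset (Fin n), ∀ z ∈ closedPolycap ζ r,
      (∀ i ∈ s, z i ∈ closedCap (ζ i) (r / 2)) → (∀ i ∉ s, ‖z i‖ = 1) →
      ‖F z‖ ≤ twoConstantsBound s.card M ε by
    simpa using H Finset.univ z (closedPolycap_mono ζ (by linarith) hz) (fun i _ => hz i) (by simp)
  intro s
  induction s using Finset.induction_on with
  | empty => intro z hz _ h1; exact htorus z hz (by simpa using h1)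
  | insert a s has ih =>
    intro z hz hs h1
    rw [Finset.card_insert_of_notMem has, twoConstantsBound_succ]
    have := two_constants (hζ a) hr hr1 (hF.continuousOn_slice z hz a)
      (hF.differentiableOn_slice hζ hr hr1 hz a) (twoConstantsBound_pos s.card hM hε)
      (fun w hw => hF.norm_le _ (update_mem_closedPolycap hz hw))
      (fun w hw hw1 => ih _ (update_mem_closedPolycap hz hw) (fun i hi => ?_) fun i hi => ?_)
      (hs a (by simp))
    · simpa using this
    · have hia : i ≠ a := fun h => has (h ▸ hi)
      simpa [hia] using hs i (by simp [hi])
    · rcases eq_or_ne i a with rfl | hia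
      · simpa using hw1
      · simpa [hia] using h1 i (by simp [hi, hia])

end Polycap

/-! ### A lacunary series without one-sided extensions -/

/-- The term `t^{-2^k} / k!`. -/
noncomputable def lacunaryTerm (k : ℕ) (w : ℂ) : ℂ := (w⁻¹) ^ (2 ^ k) / (k.factorial : ℂ)

/-- The function `t ↦ ∑ t^{-2^k} / k!` on the circle. -/
noncomputable def lacunary (t : Circle) : ℂ := ∑' k, lacunaryTerm k t

theorem norm_lacunaryTerm_circle (k : ℕ) (t : Circle) :
    ‖lacunaryTerm k t‖ = 1 / (k.factorial : ℝ) := by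
  simp [lacunaryTerm, Circle.norm_coe]

theorem summable_one_div_factorial : Summable fun k : ℕ => 1 / (k.factorial : ℝ) := by
  simpa using Real.summable_pow_div_factorial 1

theorem summable_lacunaryTerm (t : Circle) : Summable fun k => lacunaryTerm k t :=
  Summable.of_norm (by simpa only [norm_lacunaryTerm_circle] using summable_one_div_factorial)

theorem lacunaryTerm_circle_exp (k : ℕ) (s : ℝ) :
    lacunaryTerm k (Circle.exp s) =
      ((k.factorial : ℂ))⁻¹ * Complex.exp (-((2 : ℂ) ^ k * Complex.I) * s) := by
  rw [lacunaryTerm, Circle.coe_exp, ← Complex.exp_neg, ← Complex.exp_nat_mul, div_eq_inv_mul]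
  congr 2
  push_cast
  ring

theorem iteratedDeriv_exp_const_mul_ofReal (m : ℕ) (a : ℂ) :
    iteratedDeriv m (fun s : ℝ => Complex.exp (a * s)) = fun s : ℝ => a ^ m * Complex.exp (a * s) := by
  induction m with
  | zero => simp
  | succ m ih =>
    rw [iteratedDeriv_succ, ih]
    funext s
    have h : HasDerivAt (fun s : ℝ => Complex.exp (a * s)) (Complex.exp (a * s) * (a * 1)) s :=
      ((Complex.ofRealCLM.hasDerivAt (x := s)).const_mul a).cexp
    rw [(h.const_mul (a ^ m)).deriv]
    ring

/-- Differentiating `m` times multiplies the `k`-th term by `2^{mk}`, and the factorial still makes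
the series converge. -/
theorem contDiff_lacunary : ContDiff ℝ ((⊤ : ℕ∞) : WithTop ℕ∞) fun s : ℝ => lacunary (Circle.exp s) := by
  simp only [lacunary]
  refine contDiff_tsum (v := fun m k => ((2 : ℝ) ^ m) ^ k / (k.factorial : ℝ)) (fun k => ?_)
    (fun m _ => Real.summable_pow_div_factorial ((2 : ℝ) ^ m)) fun m k s _ => ?_
  · simp only [lacunaryTerm_circle_exp]
    exact contDiff_const.mul (contDiff_const.mul Complex.ofRealCLM.contDiff).cexp
  · rw [norm_iteratedFDeriv_eq_norm_iteratedDeriv]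
    simp only [lacunaryTerm_circle_exp]
    rw [iteratedDeriv_const_mul_field, iteratedDeriv_exp_const_mul_ofReal]
    have h1 : ‖Complex.exp (-((2 : ℂ) ^ k * Complex.I) * s)‖ = 1 := by
      rw [Complex.norm_exp]
      have : (-((2 : ℂ) ^ k * Complex.I) * s).re = 0 := by
        have : -((2 : ℂ) ^ k * Complex.I) * s = ((-((2 : ℝ) ^ k * s) : ℝ) : ℂ) * Complex.I := by
          push_cast; ring
        rw [this, Complex.re_ofReal_mul]; simp
      rw [this, Real.exp_zero]
    rw [norm_mul, norm_mul, h1]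
    simp only [norm_inv, Complex.norm_natCast, norm_pow, norm_neg, norm_mul, Complex.norm_I,
      Complex.norm_ofNat, mul_one]
    rw [← pow_mul, ← pow_mul, mul_comm k m, div_eq_inv_mul]

/-- Half of the exponent absorbs `k! ≤ e^{k²}`, because `k² = o(2^k)`; the other half absorbs `M`.
-/
theorem exists_mul_exp_lt_one_div_factorial (N : ℕ) (M : ℝ) {b : ℝ} (hb : 0 < b) :
    ∃ k ≥ N, M * Real.exp (-(2 ^ k * b)) < 1 / (k.factorial : ℝ) := by
  have h1 : ∀ᶠ k : ℕ in atTop, (k : ℝ) ^ 2 / 2 ^ k < b / 2 :=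
    (tendsto_pow_const_div_const_pow_of_one_lt 2 (by norm_num : (1 : ℝ) < 2)).eventually
      (gt_mem_nhds (by positivity))
  have h2 : Tendsto (fun k : ℕ => M * Real.exp (-(2 ^ k * (b / 2)))) atTop (𝓝 (M * 0)) := by
    refine Tendsto.const_mul M (Real.tendsto_exp_neg_atTop_nhds_zero.comp ?_)
    exact (tendsto_pow_atTop_atTop_of_one_lt (by norm_num : (1 : ℝ) < 2)).atTop_mul_const
      (by positivity)
  rw [mul_zero] at h2
  obtain ⟨k, hk1, hk2, hkN⟩ := (h1.and ((h2.eventually (gt_mem_nhds one_pos)).and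
    (eventually_ge_atTop N))).exists
  refine ⟨k, hkN, ?_⟩
  have hf : (k.factorial : ℝ) ≤ Real.exp (2 ^ k * (b / 2)) := by
    have hkk : (k.factorial : ℝ) ≤ (k : ℝ) ^ k := by exact_mod_cast Nat.factorial_le_pow k
    have hke : (k : ℝ) ≤ Real.exp k := by linarith [Real.add_one_le_exp (k : ℝ)]
    calc (k.factorial : ℝ) ≤ (k : ℝ) ^ k := hkk
      _ ≤ Real.exp k ^ k := pow_le_pow_left₀ (Nat.cast_nonneg k) hke k
      _ = Real.exp ((k : ℝ) ^ 2) := by rw [← Real.exp_nat_mul, sq]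
      _ ≤ _ := by
        rw [Real.exp_le_exp]
        rw [div_lt_iff₀ (by positivity)] at hk1
        linarith
  have hpos : (0 : ℝ) < k.factorial := by exact_mod_cast k.factorial_pos
  rw [lt_div_iff₀ hpos]
  rcases le_or_gt M 0 with hM | hM
  · have : M * Real.exp (-(2 ^ k * b)) ≤ 0 := mul_nonpos_of_nonpos_of_nonneg hM (Real.exp_nonneg _)
    nlinarith
  calc M * Real.exp (-(2 ^ k * b)) * k.factorial
      ≤ M * Real.exp (-(2 ^ k * b)) * Real.exp (2 ^ k * (b / 2)) := by gcongr
    _ = M * Real.exp (-(2 ^ k * (b / 2))) := by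
      rw [mul_assoc, ← Real.exp_add]; congr 2; ring
    _ < 1 := hk2

/-! ### Periodicity and Fourier coefficients of the tail -/

/-- The tail of the lacunary series. -/
noncomputable def lacunaryTail (N : ℕ) (t : Circle) : ℂ := ∑' k, lacunaryTerm (k + N) t

theorem lacunary_eq_sum_add_tail (N : ℕ) (t : Circle) :
    lacunary t = ∑ k ∈ Finset.range N, lacunaryTerm k t + lacunaryTail N t :=
  ((summable_lacunaryTerm t).sum_add_tsum_nat_add N).symm

theorem exp_two_pow_mul_period {N k : ℕ} (h : N ≤ k) :
    Complex.exp ((2 : ℂ) ^ k * Complex.I * ((2 * Real.pi / 2 ^ N : ℝ) : ℂ)) = 1 := by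
  obtain ⟨m, rfl⟩ := Nat.exists_eq_add_of_le h
  have : (2 : ℂ) ^ (N + m) * Complex.I * ((2 * Real.pi / 2 ^ N : ℝ) : ℂ) =
      ((2 ^ m : ℕ) : ℂ) * (2 * Real.pi * Complex.I) := by
    push_cast
    rw [pow_add]
    field_simp
  rw [this, Complex.exp_nat_mul_two_pi_mul_I]

theorem lacunaryTerm_mul_period {N k : ℕ} (h : N ≤ k) (w : ℂ) :
    lacunaryTerm k (w * Complex.exp (Complex.I * ((2 * Real.pi / 2 ^ N : ℝ) : ℂ))) =
      lacunaryTerm k w := by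
  have h1 : (Complex.exp (Complex.I * ((2 * Real.pi / 2 ^ N : ℝ) : ℂ))) ^ (2 ^ k) = 1 := by
    rw [← Complex.exp_nat_mul]
    have := exp_two_pow_mul_period h
    rw [mul_assoc] at this
    simpa only [Nat.cast_pow, Nat.cast_ofNat] using this
  rw [lacunaryTerm, lacunaryTerm, mul_inv, mul_pow, inv_pow _ (2 ^ k), inv_pow _ (2 ^ k), h1,
    inv_one, mul_one]

/-- All frequencies of the tail are multiples of `2^N`, so one short period, which fits into a small
arc, already isolates a Fourier coefficient. -/
theorem integral_lacunaryTail (N : ℕ) (c : Circle) {k : ℕ} (hk : N ≤ k) :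
    ∫ x in (0 : ℝ)..(2 * Real.pi / 2 ^ N), lacunaryTail N (c * Circle.exp x) *
      Complex.exp ((2 : ℂ) ^ k * Complex.I * x) =
      ((2 * Real.pi / 2 ^ N : ℝ) : ℂ) * lacunaryTerm k c := by
  set L : ℝ := 2 * Real.pi / 2 ^ N with hL
  have hterm (j : ℕ) (x : ℝ) : lacunaryTerm (j + N) ((c * Circle.exp x : Circle) : ℂ) *
      Complex.exp ((2 : ℂ) ^ k * Complex.I * x) =
      lacunaryTerm (j + N) c * Complex.exp (((2 : ℂ) ^ k - 2 ^ (j + N)) * Complex.I * x) := by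
    have h1 : lacunaryTerm (j + N) ((c * Circle.exp x : Circle) : ℂ) = lacunaryTerm (j + N) c *
        Complex.exp (-((2 : ℂ) ^ (j + N) * Complex.I) * x) := by
      have h2 : ((Circle.exp x : ℂ)⁻¹) ^ (2 ^ (j + N)) =
          Complex.exp (-((2 : ℂ) ^ (j + N) * Complex.I) * x) := by
        rw [Circle.coe_exp, ← Complex.exp_neg, ← Complex.exp_nat_mul]
        congr 1
        push_cast
        ring
      rw [lacunaryTerm, lacunaryTerm, Circle.coe_mul, mul_inv, mul_pow, h2]
      ring
    rw [h1, mul_assoc, ← Complex.exp_add]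
    congr 2
    ring
  have hsum : HasSum (fun j => ∫ x in (0 : ℝ)..L, lacunaryTerm (j + N) ((c * Circle.exp x : Circle) : ℂ) *
      Complex.exp ((2 : ℂ) ^ k * Complex.I * x)) (∫ x in (0 : ℝ)..L, lacunaryTail N (c * Circle.exp x) *
      Complex.exp ((2 : ℂ) ^ k * Complex.I * x)) := by
    refine intervalIntegral.hasSum_integral_of_dominated_convergence
      (fun j _ => 1 / ((j + N).factorial : ℝ)) (fun j => ?_) (fun j => ?_) ?_ ?_ ?_
    · simp only [hterm]
      exact Continuous.aestronglyMeasurable (by fun_prop)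
    · refine Eventually.of_forall fun x _ => ?_
      rw [norm_mul, norm_lacunaryTerm_circle]
      have : ‖Complex.exp ((2 : ℂ) ^ k * Complex.I * x)‖ = 1 := by
        have h3 : (2 : ℂ) ^ k * Complex.I * x = (((2 : ℝ) ^ k * x : ℝ) : ℂ) * Complex.I := by
          push_cast; ring
        rw [h3, Complex.norm_exp_ofReal_mul_I]
      rw [this, mul_one]
    · exact Eventually.of_forall fun x _ => (summable_nat_add_iff N).2 summable_one_div_factorial
    · exact intervalIntegrable_const
    · refine Eventually.of_forall fun x _ => HasSum.mul_right _ ?_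
      exact ((summable_nat_add_iff N).2 (summable_lacunaryTerm _)).hasSum
  refine hsum.unique ?_
  have hval (j : ℕ) : ∫ x in (0 : ℝ)..L, lacunaryTerm (j + N) ((c * Circle.exp x : Circle) : ℂ) *
      Complex.exp ((2 : ℂ) ^ k * Complex.I * x) = if j = k - N then (L : ℂ) * lacunaryTerm k c else 0 := by
    simp only [hterm]
    rw [intervalIntegral.integral_const_mul]
    split_ifs with h
    · have : j + N = k := by omega
      rw [this]
      simp [mul_comm]
    · have hne : (2 : ℂ) ^ k - 2 ^ (j + N) ≠ 0 := by
        rw [sub_ne_zero]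
        intro h2
        have h3 : (2 : ℕ) ^ k = 2 ^ (j + N) := by exact_mod_cast h2
        have := Nat.pow_right_injective le_rfl h3
        omega
      rw [integral_exp_mul_complex (mul_ne_zero hne Complex.I_ne_zero)]
      have h4 : Complex.exp (((2 : ℂ) ^ k - 2 ^ (j + N)) * Complex.I * (L : ℂ)) = 1 := by
        rw [sub_mul, sub_mul, Complex.exp_sub, exp_two_pow_mul_period hk,
          exp_two_pow_mul_period (Nat.le_add_left N j), div_one]
      rw [h4]
      simp
  simp only [hval]
  exact hasSum_ite_eq _ _

/-! ### Approximation on caps and the contour argument -/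

/-- `h` is, up to `ε`, the boundary value on an arc of the circle of a holomorphic function on a cap
that is bounded by `M`. -/
def CapApproximable (c : Circle) (r M ε : ℝ) (h : Circle → ℂ) : Prop :=
  ∃ G : ℂ → ℂ, ContinuousOn G (closedCap c r) ∧ DifferentiableOn ℂ G (openCap c r) ∧
    (∀ w ∈ closedCap c r, ‖G w‖ ≤ M) ∧
    ∀ t : Circle, (t : ℂ) ∈ closedCap c r → ‖G t - h t‖ ≤ ε

/-- Keeps the cap away from `0`, the pole of the terms `lacunaryTerm`. -/
theorem half_le_norm_of_mem_closedCap {c w : ℂ} (hc : ‖c‖ = 1) {r : ℝ} (hr : r ≤ 1 / 2)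
    (hw : w ∈ closedCap c r) : 1 / 2 ≤ ‖w‖ := by
  have h1 := Complex.re_le_norm (w * conj c)
  rw [norm_mul, RCLike.norm_conj, hc, mul_one] at h1
  linarith [hw.2]

theorem differentiableAt_lacunaryTerm (k : ℕ) {w : ℂ} (hw : w ≠ 0) :
    DifferentiableAt ℂ (lacunaryTerm k) w :=
  ((differentiableAt_inv hw).pow _).div_const _

theorem norm_lacunaryTerm_le (k : ℕ) {w : ℂ} (hw : 1 / 2 ≤ ‖w‖) :
    ‖lacunaryTerm k w‖ ≤ 2 ^ (2 ^ k) / (k.factorial : ℝ) := by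
  rw [lacunaryTerm, norm_div, norm_pow, norm_inv, Complex.norm_natCast]
  have : ‖w‖⁻¹ ≤ 2 := by
    rw [inv_le_comm₀ (by linarith) two_pos]; linarith
  gcongr

/-- In the coordinate `τ` rotation becomes translation, and the cap contains a rectangle resting on
the real axis. -/
theorem mul_exp_mem_closedCap (c : Circle) {s : ℝ} (hs : s ≤ 1) {τ : ℂ} (h0 : 0 ≤ τ.im)
    (hτ : 2 * ‖τ‖ ≤ s) : (c : ℂ) * Complex.exp (Complex.I * τ) ∈ closedCap c s := by
  have hre : (Complex.I * τ).re = -τ.im := by simp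
  constructor
  · rw [norm_mul, Circle.norm_coe, one_mul, Complex.norm_exp, hre]
    exact Real.exp_le_one_iff.2 (by linarith)
  · have h1 : (c : ℂ) * Complex.exp (Complex.I * τ) * conj (c : ℂ) =
        1 + (Complex.exp (Complex.I * τ) - 1) := by
      have := mul_conj_self (Circle.norm_coe c)
      linear_combination (Complex.exp (Complex.I * τ)) * this
    have h2 : ‖Complex.exp (Complex.I * τ) - 1‖ ≤ 2 * ‖τ‖ := by
      refine (Complex.norm_exp_sub_one_le (by simp; linarith)).trans (by simp)
    have h3 := Complex.abs_re_le_norm (Complex.exp (Complex.I * τ) - 1)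
    rw [h1, Complex.add_re, Complex.one_re]
    linarith [neg_abs_le (Complex.exp (Complex.I * τ) - 1).re]

theorem mul_exp_mem_openCap (c : Circle) {s : ℝ} (hs : s ≤ 1) {τ : ℂ} (h0 : 0 < τ.im)
    (hτ : 2 * ‖τ‖ < s) : (c : ℂ) * Complex.exp (Complex.I * τ) ∈ openCap c s := by
  have h := mul_exp_mem_closedCap c (s := 2 * ‖τ‖) (hτ.le.trans hs) h0.le le_rfl
  refine ⟨?_, by linarith [h.2]⟩
  rw [norm_mul, Circle.norm_coe, one_mul, Complex.norm_exp]
  have hre : (Complex.I * τ).re = -τ.im := by simp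
  rw [hre]
  exact Real.exp_lt_one_iff.2 (by linarith)

theorem sub_le_re_mul_exp_period {c w : ℂ} (hc : ‖c‖ = 1) {L : ℝ} (hL0 : 0 ≤ L)
    (hL1 : L ≤ 1) (hw : ‖w‖ ≤ 1) :
    (w * conj c).re - 2 * L ≤ (w * Complex.exp (Complex.I * L) * conj c).re := by
  have h1 : w * Complex.exp (Complex.I * L) * conj c =
      w * conj c + w * conj c * (Complex.exp (Complex.I * L) - 1) := by ring
  have h2 : ‖w * conj c * (Complex.exp (Complex.I * L) - 1)‖ ≤ 2 * L := by
    rw [norm_mul, norm_mul, RCLike.norm_conj, hc, mul_one]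
    have h3 : ‖Complex.exp (Complex.I * L) - 1‖ ≤ 2 * L := by
      refine (Complex.norm_exp_sub_one_le ?_).trans ?_ <;> simp [abs_of_nonneg hL0, hL1]
    calc ‖w‖ * ‖Complex.exp (Complex.I * L) - 1‖ ≤ 1 * (2 * L) :=
          mul_le_mul hw h3 (norm_nonneg _) zero_le_one
      _ = _ := one_mul _
  have h4 := Complex.abs_re_le_norm (w * conj c * (Complex.exp (Complex.I * L) - 1))
  rw [h1, Complex.add_re]
  linarith [neg_abs_le (w * conj c * (Complex.exp (Complex.I * L) - 1)).re]

theorem continuous_lacunaryTail (N : ℕ) : Continuous (lacunaryTail N) := by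
  refine continuous_tsum (fun k => ?_) ((summable_nat_add_iff N).2 summable_one_div_factorial)
    fun k t => (norm_lacunaryTerm_circle _ t).le
  simp only [lacunaryTerm]
  exact ((Continuous.inv₀ continuous_subtype_val fun t => Circle.coe_ne_zero t).pow _).div_const _

/-- The quantitative estimate for the coefficients of the lacunary series that a cap approximation
implies. -/
theorem one_div_factorial_le_of_capApproximable {c : Circle} {r M ε : ℝ} (hr : 0 < r)
    (hr1 : r ≤ 1 / 2) (hε : 0 < ε) (h : CapApproximable c r M ε lacunary) {N k : ℕ}
    (hk : N ≤ k) (hL : 2 * Real.pi / 2 ^ N ≤ r / 16) :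
    (2 * Real.pi / 2 ^ N) * (1 / (k.factorial : ℝ)) ≤ (2 * Real.pi / 2 ^ N) * ε +
      r / 16 * √(2 * (M + ∑ j ∈ Finset.range N, 2 ^ (2 ^ j) / (j.factorial : ℝ)) * (2 * ε)) +
      (2 * Real.pi / 2 ^ N) * ((M + ∑ j ∈ Finset.range N, 2 ^ (2 ^ j) / (j.factorial : ℝ)) *
        Real.exp (-(2 ^ k * (r / 16)))) := by
  obtain ⟨G, hGc, hGd, hGM, hGε⟩ := h
  set L : ℝ := 2 * Real.pi / 2 ^ N with hLdef
  set b : ℝ := r / 16 with hb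
  set M₁ : ℝ := M + ∑ j ∈ Finset.range N, 2 ^ (2 ^ j) / (j.factorial : ℝ) with hM₁
  have hL0 : 0 < L := by positivity
  have hb0 : 0 < b := by positivity
  have hcn : ‖(c : ℂ)‖ = 1 := Circle.norm_coe c
  have hne {w : ℂ} (hw : w ∈ closedCap c r) : w ≠ 0 := fun h0 => by
    have := half_le_norm_of_mem_closedCap hcn hr1 hw
    rw [h0, norm_zero] at this
    linarith
  -- Without its first `N` terms the boundary function has period `L`, at the price of the larger
  -- bound `M₁`.
  set R : ℂ → ℂ := fun w => G w - ∑ j ∈ Finset.range N, lacunaryTerm j w with hR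
  have hRc : ContinuousOn R (closedCap c r) := hGc.sub (continuousOn_finsetSum _ fun j _ w hw =>
    (differentiableAt_lacunaryTerm j (hne hw)).continuousAt.continuousWithinAt)
  have hRd : DifferentiableOn ℂ R (openCap c r) := hGd.sub (DifferentiableOn.fun_sum fun j _ w hw =>
    (differentiableAt_lacunaryTerm j
      (hne (openCap_subset_closedCap _ _ hw))).differentiableWithinAt)
  have hRM : ∀ w ∈ closedCap c r, ‖R w‖ ≤ M₁ := fun w hw => by
    refine (norm_sub_le _ _).trans (add_le_add (hGM w hw) ((norm_sum_le _ _).trans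
      (Finset.sum_le_sum fun j _ => norm_lacunaryTerm_le j
        (half_le_norm_of_mem_closedCap hcn hr1 hw))))
  have hRε : ∀ t : Circle, (t : ℂ) ∈ closedCap c r → ‖R t - lacunaryTail N t‖ ≤ ε := fun t ht => by
    have := hGε t ht
    rw [lacunary_eq_sum_add_tail N t] at this
    simp only [hR]
    rwa [sub_sub]
  set ω : ℂ := Complex.exp (Complex.I * L) with hω
  have hωC : ω = (Circle.exp L : ℂ) := by rw [hω, Circle.coe_exp, mul_comm]
  have htail : ∀ t : Circle, lacunaryTail N (t * Circle.exp L) = lacunaryTail N t := fun t => by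
    simp only [lacunaryTail, Circle.coe_mul]
    rw [← hωC]
    exact tsum_congr fun j => lacunaryTerm_mul_period (Nat.le_add_left N j) _
  have hωnorm (w : ℂ) : ‖w * ω‖ = ‖w‖ := by rw [norm_mul, hωC, Circle.norm_coe, mul_one]
  have hωmem {w : ℂ} (hw : w ∈ closedCap c (r / 2)) : w * ω ∈ closedCap c r :=
    ⟨(hωnorm w).le.trans hw.1, by
      linarith [sub_le_re_mul_exp_period hcn hL0.le (by linarith) hw.1, hw.2]⟩
  -- `R` is nearly invariant under rotation by `L` on the arc, hence also inside. Rotation loses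
  -- depth at most `2 L ≤ r / 8`, so it maps the `r / 2` cap into the `r` cap.
  have hdefect : ∀ w ∈ closedCap c (r / 2 / 2), ‖R (w * ω) - R w‖ ≤ √(2 * M₁ * (2 * ε)) := by
    intro w hw
    refine two_constants (g := fun w => R (w * ω) - R w) hcn (r := r / 2) (by linarith)
      (by linarith) ?_ ?_ (by linarith)
      (fun w hw => ?_) (fun w hw hw1 => ?_) hw
    · exact (hRc.comp (by fun_prop) fun w hw => hωmem hw).sub
        (hRc.mono (closedCap_mono _ (by linarith)))
    · refine (hRd.comp (by fun_prop) fun w hw => ?_).sub (hRd.mono (openCap_mono _ (by linarith)))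
      exact ⟨(hωnorm w).trans_lt hw.1, by
        linarith [sub_le_re_mul_exp_period hcn hL0.le (by linarith) hw.1.le, hw.2]⟩
    · refine (norm_sub_le _ _).trans ?_
      linarith [hRM _ (hωmem hw), hRM w (closedCap_mono _ (by linarith) hw)]
    · set t : Circle := ⟨w, mem_sphere_zero_iff_norm.2 hw1⟩ with ht
      have h1 := hRε t (closedCap_mono _ (by linarith) hw)
      have h2 := hRε (t * Circle.exp L) (by rw [Circle.coe_mul, ← hωC]; exact hωmem hw)
      rw [htail, Circle.coe_mul, ← hωC] at h2
      have h3 : R (w * ω) - R w = (R (w * ω) - lacunaryTail N t) - (R w - lacunaryTail N t) := by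
        ring
      rw [h3]
      refine (norm_sub_le _ _).trans ?_
      rw [two_mul]
      exact add_le_add h2 h1
  -- Cauchy's theorem is applied on `[0, L] × [0, b]`. The bottom gives almost `L` times the `k`-th
  -- term at `c`, the top is damped by `e^{-2^k b}`, and the sides nearly cancel, since the
  -- exponential has period `L`. As `L, b ≤ r / 16`, the rectangle lands in the cap of depth `r /
  -- 4`.
  set f : ℂ → ℂ := fun τ =>
    R (c * Complex.exp (Complex.I * τ)) * Complex.exp ((2 : ℂ) ^ k * Complex.I * τ) with hf
  have hsmall {τ : ℂ} (h1 : 0 ≤ τ.re) (h2 : τ.re ≤ L) (h3 : 0 ≤ τ.im) (h4 : τ.im ≤ b) :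
      2 * ‖τ‖ ≤ r / 2 / 2 := by
    have := Complex.norm_le_abs_re_add_abs_im τ
    rw [abs_of_nonneg h1, abs_of_nonneg h3] at this
    linarith
  have hmem {τ : ℂ} (h1 : 0 ≤ τ.re) (h2 : τ.re ≤ L) (h3 : 0 ≤ τ.im) (h4 : τ.im ≤ b) :
      (c : ℂ) * Complex.exp (Complex.I * τ) ∈ closedCap c (r / 2 / 2) :=
    mul_exp_mem_closedCap c (by linarith) h3 (hsmall h1 h2 h3 h4)
  have hsub : closedCap (c : ℂ) (r / 2 / 2) ⊆ closedCap c r := closedCap_mono _ (by linarith)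
  have hfc : ContinuousOn f (Icc 0 L ×ℂ Icc 0 b) := by
    refine (hRc.comp (by fun_prop) fun τ hτ => ?_).mul (by fun_prop)
    exact hsub (hmem hτ.1.1 hτ.1.2 hτ.2.1 hτ.2.2)
  have hfd : DifferentiableOn ℂ f (Ioo 0 L ×ℂ Ioo 0 b) := by
    refine (hRd.comp (by fun_prop) fun τ hτ => ?_).mul (by fun_prop)
    refine mul_exp_mem_openCap c (by linarith) hτ.2.1 ?_
    linarith [hsmall hτ.1.1.le hτ.1.2.le hτ.2.1.le hτ.2.2.le]
  have hrect := Complex.integral_boundary_rect_eq_zero_of_continuousOn_of_differentiableOn f 0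
    (L + b * Complex.I) (by simpa [uIcc_of_le hL0.le, uIcc_of_le hb0.le] using hfc)
    (by simpa [min_eq_left hL0.le, min_eq_left hb0.le, max_eq_right hL0.le,
      max_eq_right hb0.le] using hfd)
  simp only [Complex.zero_re, Complex.zero_im, Complex.add_re, Complex.ofReal_re, Complex.mul_re,
    Complex.I_re, mul_zero, Complex.ofReal_im, Complex.I_im, mul_one, sub_self, add_zero,
    Complex.add_im, Complex.mul_im, zero_add, Complex.ofReal_zero, zero_mul, smul_eq_mul] at hrect
  have hexp (x y : ℝ) : ‖Complex.exp ((2 : ℂ) ^ k * Complex.I * (x + y * Complex.I))‖ =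
      Real.exp (-(2 ^ k * y)) := by
    have : (2 : ℂ) ^ k * Complex.I * (x + y * Complex.I) =
        ((2 ^ k : ℝ) : ℂ) * (Complex.I * (x + y * Complex.I)) := by push_cast; ring
    rw [Complex.norm_exp, this, Complex.re_ofReal_mul]
    simp
  have hbottom : ‖(∫ x in (0 : ℝ)..L, f x) - (L : ℂ) * lacunaryTerm k c‖ ≤ L * ε := by
    rw [← integral_lacunaryTail N c hk, ← hLdef, ← intervalIntegral.integral_sub]
    · have := intervalIntegral.norm_integral_le_of_norm_le_const (a := 0) (b := L) (C := ε)
        (f := fun x : ℝ => f x - lacunaryTail N (c * Circle.exp x) *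
          Complex.exp ((2 : ℂ) ^ k * Complex.I * x)) fun x hx => ?_
      · rw [sub_zero, abs_of_pos hL0] at this
        exact this.trans_eq (mul_comm _ _)
      · rw [uIoc_of_le hL0.le] at hx
        have h1 : ((c * Circle.exp x : Circle) : ℂ) = c * Complex.exp (Complex.I * x) := by
          rw [Circle.coe_mul, Circle.coe_exp, mul_comm Complex.I]
        have h2 := hRε (c * Circle.exp x) (by
          rw [h1]; exact hsub (hmem (by simpa using hx.1.le) (by simpa using hx.2) (by simp)
            (by simpa using hb0.le)))
        have h3 := hexp x 0
        simp only [Complex.ofReal_zero, zero_mul, add_zero, mul_zero, neg_zero, Real.exp_zero] at h3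
        rw [hf, ← sub_mul, norm_mul, h3, mul_one, ← h1]
        exact h2
    · refine ContinuousOn.intervalIntegrable (hfc.comp (by fun_prop) fun x hx => ?_)
      rw [uIcc_of_le hL0.le] at hx
      exact ⟨by simpa using hx, by simpa using hb0.le⟩
    · refine Continuous.intervalIntegrable ?_ _ _
      exact ((continuous_lacunaryTail N).comp (by fun_prop)).mul (by fun_prop)
  have htop : ‖∫ x in (0 : ℝ)..L, f (x + b * Complex.I)‖ ≤
      M₁ * Real.exp (-(2 ^ k * b)) * L := by
    have := intervalIntegral.norm_integral_le_of_norm_le_const (a := 0) (b := L)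
      (C := M₁ * Real.exp (-(2 ^ k * b))) (f := fun x : ℝ => f (x + b * Complex.I)) fun x hx => ?_
    · rwa [sub_zero, abs_of_pos hL0] at this
    · rw [uIoc_of_le hL0.le] at hx
      rw [hf, norm_mul, hexp]
      refine mul_le_mul_of_nonneg_right (hRM _ (hsub (hmem ?_ ?_ ?_ ?_))) (Real.exp_nonneg _)
      · simpa using hx.1.le
      · simpa using hx.2
      · simpa using hb0.le
      · simp
  have hside : ‖(∫ y in (0 : ℝ)..b, f (L + y * Complex.I)) -
      ∫ y in (0 : ℝ)..b, f (y * Complex.I)‖ ≤ √(2 * M₁ * (2 * ε)) * b := by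
    rw [← intervalIntegral.integral_sub]
    · have := intervalIntegral.norm_integral_le_of_norm_le_const (a := 0) (b := b)
        (C := √(2 * M₁ * (2 * ε)))
        (f := fun y : ℝ => f (L + y * Complex.I) - f (y * Complex.I)) fun y hy => ?_
      · rwa [sub_zero, abs_of_pos hb0] at this
      · rw [uIoc_of_le hb0.le] at hy
        have h1 : (c : ℂ) * Complex.exp (Complex.I * (L + y * Complex.I)) =
            c * Complex.exp (Complex.I * (y * Complex.I)) * ω := by
          rw [hω, mul_assoc, ← Complex.exp_add, mul_add, add_comm]
        have h2 : Complex.exp ((2 : ℂ) ^ k * Complex.I * (L + y * Complex.I)) =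
            Complex.exp ((2 : ℂ) ^ k * Complex.I * (y * Complex.I)) := by
          rw [mul_add, Complex.exp_add, hLdef, exp_two_pow_mul_period hk, one_mul]
        have h3 := hexp 0 y
        rw [Complex.ofReal_zero, zero_add] at h3
        rw [hf]
        simp only
        rw [h1, h2, ← sub_mul, norm_mul, h3]
        refine (mul_le_of_le_one_right (norm_nonneg _) (Real.exp_le_one_iff.2 ?_)).trans
          (hdefect _ (hmem (by simp) (by simpa using hL0.le) (by simpa using hy.1.le)
            (by simpa using hy.2)))
        have : 0 ≤ 2 ^ k * y := mul_nonneg (by positivity) hy.1.le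
        linarith
    · refine ContinuousOn.intervalIntegrable (hfc.comp (by fun_prop) fun y hy => ?_)
      rw [uIcc_of_le hb0.le] at hy
      exact ⟨by simpa using hL0.le, by simpa using hy⟩
    · refine ContinuousOn.intervalIntegrable (hfc.comp (by fun_prop) fun y hy => ?_)
      rw [uIcc_of_le hb0.le] at hy
      exact ⟨by simpa using hL0.le, by simpa using hy⟩
  have hnorm : ‖(L : ℂ) * lacunaryTerm k c‖ = L * (1 / (k.factorial : ℝ)) := by
    rw [norm_mul, norm_lacunaryTerm_circle, Complex.norm_real, Real.norm_of_nonneg hL0.le]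
  set A := ∫ x in (0 : ℝ)..L, f x
  set T := ∫ x in (0 : ℝ)..L, f (x + b * Complex.I)
  set S₁ := ∫ y in (0 : ℝ)..b, f (L + y * Complex.I)
  set S₂ := ∫ y in (0 : ℝ)..b, f (y * Complex.I)
  have hA : (L : ℂ) * lacunaryTerm k c =
      T - Complex.I * (S₁ - S₂) - (A - (L : ℂ) * lacunaryTerm k c) := by
    linear_combination hrect
  rw [← hnorm, hA]
  have h1 := norm_sub_le (T - Complex.I * (S₁ - S₂)) (A - (L : ℂ) * lacunaryTerm k c)
  have h2 := norm_sub_le T (Complex.I * (S₁ - S₂))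
  rw [norm_mul, Complex.norm_I, one_mul] at h2
  linarith

/-- The lacunary series is not approximable on any cap with a uniform bound. -/
theorem lacunary_not_capApproximable (c : Circle) {r : ℝ} (hr : 0 < r) (hr1 : r ≤ 1 / 2) (M : ℝ) :
    ¬ ∀ ε > 0, CapApproximable c r M ε lacunary := by
  intro h
  -- The order of choices matters: `N` fixes `M₁`, then `k` is taken large, and only then does `ε`
  -- tend to `0`, which leaves the top side alone.
  obtain ⟨N, hN⟩ : ∃ N : ℕ, 2 * Real.pi / 2 ^ N ≤ r / 16 := by
    have : Tendsto (fun N : ℕ => 2 * Real.pi / 2 ^ N) atTop (𝓝 0) :=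
      tendsto_const_nhds.div_atTop (tendsto_pow_atTop_atTop_of_one_lt one_lt_two)
    exact (this.eventually (ge_mem_nhds (by positivity))).exists
  set M₁ : ℝ := M + ∑ j ∈ Finset.range N, 2 ^ (2 ^ j) / (j.factorial : ℝ) with hM₁
  obtain ⟨k, hk, hlt⟩ := exists_mul_exp_lt_one_div_factorial N M₁ (b := r / 16) (by positivity)
  have hL0 : 0 < 2 * Real.pi / 2 ^ N := by positivity
  have hlim : Tendsto (fun ε : ℝ => (2 * Real.pi / 2 ^ N) * ε + r / 16 * √(2 * M₁ * (2 * ε)) +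
      (2 * Real.pi / 2 ^ N) * (M₁ * Real.exp (-(2 ^ k * (r / 16))))) (𝓝[>] 0)
      (𝓝 ((2 * Real.pi / 2 ^ N) * 0 + r / 16 * √(2 * M₁ * (2 * 0)) +
      (2 * Real.pi / 2 ^ N) * (M₁ * Real.exp (-(2 ^ k * (r / 16)))))) := by
    refine Tendsto.mono_left (Continuous.tendsto ?_ 0) nhdsWithin_le_nhds
    fun_prop
  have hle := ge_of_tendsto hlim (b := (2 * Real.pi / 2 ^ N) * (1 / (k.factorial : ℝ))) (by
    filter_upwards [self_mem_nhdsWithin] with ε hε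
    exact one_div_factorial_le_of_capApproximable hr hr1 hε (h ε hε) hk hN)
  simp only [mul_zero, Real.sqrt_zero, zero_add] at hle
  exact absurd (le_of_mul_le_mul_left hle hL0) (not_le.2 hlt)

/-! ### The topology of `C^p(𝕋ⁿ)` and residual sets -/

namespace CpTorus

variable {n : ℕ} {p : ℕ∞}

theorem withSeminorms_seminorm (n : ℕ) (p : ℕ∞) : WithSeminorms (seminorm n p) := ⟨rfl⟩

instance : IsTopologicalAddGroup (CpTorus n p) := (withSeminorms_seminorm n p).topologicalAddGroup

instance : ContinuousSMul ℂ (CpTorus n p) := (withSeminorms_seminorm n p).continuousSMul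

theorem mixedDeriv_zero (f : Torus n → ℂ) : mixedDeriv 0 f = f := by
  unfold mixedDeriv
  induction List.finRange n with
  | nil => rfl
  | cons i l _ => simp

theorem norm_toFun_le_seminorm (f : CpTorus n p) (z : Torus n) :
    ‖f.toFun z‖ ≤ seminorm n p ⟨0, by simp⟩ f := by
  have h := le_ciSup (f.bddAbove_mixedDeriv ⟨0, by simp⟩) z
  simp only [mixedDeriv_zero] at h
  refine h.trans_eq ?_
  change _ = ⨆ z, _
  simp only [mixedDeriv_zero]

/-- The closure arguments below use only this: the topology is at least as fine as that of uniform
convergence. -/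
theorem exists_mem_forall_norm_sub_le {A : Set (CpTorus n p)} {f : CpTorus n p}
    (hf : f ∈ closure A) {ε : ℝ} (hε : 0 < ε) :
    ∃ g ∈ A, ∀ z, ‖g.toFun z - f.toFun z‖ ≤ ε := by
  have hc : Continuous fun g : CpTorus n p => seminorm n p ⟨0, by simp⟩ (g - f) :=
    ((withSeminorms_seminorm n p).continuous_seminorm _).comp (continuous_id.sub continuous_const)
  obtain ⟨g, hg, hgA⟩ := _root_.mem_closure_iff.1 hf _ (isOpen_lt hc (continuous_const (y := ε)))
    (by simpa using hε)
  exact ⟨g, hgA, fun z => (norm_toFun_le_seminorm (g - f) z).trans (le_of_lt hg)⟩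

theorem continuous_toFun (f : CpTorus n p) : Continuous f.toFun := IsCp.continuous f.2

/-- The lacunary series in the first variable. -/
noncomputable def lacunaryFun (j : Fin n) (p : ℕ∞) : CpTorus n p :=
  ⟨fun t => lacunary (t j), by
    have h : ContDiff ℝ ((⊤ : ℕ∞) : WithTop ℕ∞) fun θ : Fin n → ℝ => lacunary (Circle.exp (θ j)) :=
      contDiff_lacunary.comp (contDiff_apply ℝ ℝ j)
    exact IsCp.of_le (p := ⊤) (f := fun t : Torus n => lacunary (t j)) h le_top⟩

/-- The functions whose restriction to the curve `σ` is arbitrarily well approximable on a cap,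
with the bound `M`. -/
def approximable (n : ℕ) (p : ℕ∞) (σ : Circle → Torus n) (c : Circle) (r M : ℝ) :
    Set (CpTorus n p) :=
  {f | ∀ ε > 0, CapApproximable c r M ε fun t => f.toFun (σ t)}

/-- Since every `ε` is allowed, half of it pays for replacing `f` by a nearby `g`; no limit of the
functions `G` is needed. -/
theorem isClosed_approximable (σ : Circle → Torus n) (c : Circle) (r M : ℝ) :
    IsClosed (approximable n p σ c r M) := by
  refine isClosed_of_closure_subset fun f hf ε hε => ?_
  obtain ⟨g, hg, hgf⟩ := exists_mem_forall_norm_sub_le hf (half_pos hε)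
  obtain ⟨G, hGc, hGd, hGM, hGε⟩ := hg (ε / 2) (half_pos hε)
  refine ⟨G, hGc, hGd, hGM, fun t ht => ?_⟩
  have := norm_add_le (G t - g.toFun (σ t)) (g.toFun (σ t) - f.toFun (σ t))
  rw [sub_add_sub_cancel] at this
  linarith [hGε t ht, hgf (σ t)]

theorem sub_mem_approximable {σ : Circle → Torus n} {c : Circle} {r M M' : ℝ} {f g : CpTorus n p}
    (hf : f ∈ approximable n p σ c r M) (hg : g ∈ approximable n p σ c r M') :
    f - g ∈ approximable n p σ c r (M + M') := by
  intro ε hε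
  obtain ⟨F, hFc, hFd, hFM, hFε⟩ := hf (ε / 2) (half_pos hε)
  obtain ⟨G, hGc, hGd, hGM, hGε⟩ := hg (ε / 2) (half_pos hε)
  refine ⟨fun w => F w - G w, hFc.sub hGc, hFd.sub hGd, fun w hw =>
    (norm_sub_le _ _).trans (add_le_add (hFM w hw) (hGM w hw)), fun t ht => ?_⟩
  have h1 : F t - G t - (f - g).toFun (σ t) =
      (F t - f.toFun (σ t)) - (G t - g.toFun (σ t)) := by
    change F t - G t - (f.toFun (σ t) - g.toFun (σ t)) = _
    ring
  change ‖F t - G t - (f - g).toFun (σ t)‖ ≤ ε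
  rw [h1]
  refine (norm_sub_le _ _).trans ?_
  linarith [hFε t ht, hGε t ht]

theorem smul_mem_approximable {σ : Circle → Torus n} {c : Circle} {r M : ℝ} {f : CpTorus n p}
    (hf : f ∈ approximable n p σ c r M) {a : ℂ} (ha : a ≠ 0) :
    a • f ∈ approximable n p σ c r (‖a‖ * M) := by
  intro ε hε
  have ha' : 0 < ‖a‖ := norm_pos_iff.2 ha
  obtain ⟨F, hFc, hFd, hFM, hFε⟩ := hf (ε / ‖a‖) (div_pos hε ha')
  refine ⟨fun w => a * F w, continuousOn_const.mul hFc, hFd.const_mul a, fun w hw => ?_,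
    fun t ht => ?_⟩
  · rw [norm_mul]
    exact mul_le_mul_of_nonneg_left (hFM w hw) ha'.le
  · change ‖a * F t - a * f.toFun (σ t)‖ ≤ ε
    rw [← mul_sub, norm_mul]
    have := hFε t ht
    rwa [le_div_iff₀' ha'] at this

theorem lacunaryFun_notMem_approximable {j : Fin n} {σ : Circle → Torus n} (hσ : ∀ t, σ t j = t)
    (c : Circle) {r : ℝ} (hr : 0 < r) (hr1 : r ≤ 1 / 2) (M : ℝ) :
    lacunaryFun j p ∉ approximable n p σ c r M := by
  intro h
  refine lacunary_not_capApproximable c hr hr1 M fun ε hε => ?_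
  have := h ε hε
  change CapApproximable c r M ε fun t => lacunary (σ t j) at this
  simpa only [hσ] using this

/-- The functions that are approximable on none of countably many curves. -/
def nowhereApproximable (n : ℕ) (p : ℕ∞) {ι : Type*} (σ : ι → Circle → Torus n) (c : ι → Circle)
    (r : ι → ℝ) : Set (CpTorus n p) :=
  ⋂ i : ι × ℕ, (approximable n p (σ i.1) (c i.1) (r i.1) i.2)ᶜ

theorem isGδ_nowhereApproximable {ι : Type*} [Countable ι] (σ : ι → Circle → Torus n)
    (c : ι → Circle) (r : ι → ℝ) : IsGδ (nowhereApproximable n p σ c r) :=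
  .iInter_of_isOpen fun _ => (isClosed_approximable _ _ _ _).isOpen_compl

/-- On the real line `f + s • lacunaryFun j p` each curve excludes at most one `s`, whatever the
bounds `M`. The complement of a countable set of reals is dense. -/
theorem dense_nowhereApproximable {ι : Type*} [Countable ι] {j : Fin n} {σ : ι → Circle → Torus n}
    (hσ : ∀ i t, σ i t j = t) (c : ι → Circle) {r : ι → ℝ} (hr : ∀ i, 0 < r i)
    (hr1 : ∀ i, r i ≤ 1 / 2) : Dense (nowhereApproximable n p σ c r) := by
  intro f
  rw [_root_.mem_closure_iff]
  intro U hU hfU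
  set γ : ℝ → CpTorus n p := fun s => f + (s : ℂ) • lacunaryFun j p with hγ
  have hγc : Continuous γ := by
    refine continuous_const.add (Continuous.smul Complex.continuous_ofReal continuous_const)
  have hbad : Set.Countable
      (⋃ i, {s : ℝ | ∃ M : ℕ, γ s ∈ approximable n p (σ i) (c i) (r i) M}) := by
    refine countable_iUnion fun i => Set.Subsingleton.countable ?_
    rintro s ⟨M, hM⟩ s' ⟨M', hM'⟩
    by_contra hne
    have hne' : ((s - s' : ℝ) : ℂ) ≠ 0 := Complex.ofReal_ne_zero.2 (sub_ne_zero.2 hne)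
    have h1 := smul_mem_approximable (sub_mem_approximable hM hM') (inv_ne_zero hne')
    have h2 : ((s - s' : ℝ) : ℂ)⁻¹ • (γ s - γ s') = lacunaryFun j p := by
      simp only [hγ]
      rw [add_sub_add_left_eq_sub, ← sub_smul, smul_smul, ← Complex.ofReal_sub,
        inv_mul_cancel₀ hne', one_smul]
    rw [h2] at h1
    exact lacunaryFun_notMem_approximable (hσ i) _ (hr i) (hr1 i) _ h1
  obtain ⟨s, hsU, hs⟩ := (hbad.dense_compl ℝ).inter_open_nonempty _ (hU.preimage hγc)
    ⟨0, by simpa [hγ] using hfU⟩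
  refine ⟨γ s, hsU, mem_iInter.2 fun i hi => hs (mem_iUnion.2 ⟨i.1, i.2, hi⟩)⟩

end CpTorus

/-! ### The domains -/

section Domains

variable {n : ℕ}

theorem norm_torusPoint (t : Torus n) (i : Fin n) : ‖torusPoint t i‖ = 1 := Circle.norm_coe (t i)

theorem continuous_torusPoint : Continuous (torusPoint : Torus n → Fin n → ℂ) :=
  continuous_pi fun i => continuous_subtype_val.comp (continuous_apply i)

theorem isOpen_polydisc (n : ℕ) : IsOpen (polydisc n) := by
  have : polydisc n = ⋂ i, {z | ‖z i‖ < 1} := by ext; simp [polydisc]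
  rw [this]
  exact isOpen_iInter_of_finite fun i =>
    isOpen_lt (continuous_apply i).norm continuous_const

theorem closure_polydisc (n : ℕ) : closure (polydisc n) = {z | ∀ i, ‖z i‖ ≤ 1} := by
  have h : polydisc n = Set.pi univ fun _ => ball (0 : ℂ) 1 := by ext; simp [polydisc]
  rw [h, closure_pi_set]
  ext z
  simp [closure_ball (0 : ℂ) one_ne_zero]

theorem torusPoint_mem_closure_polydisc (t : Torus n) : torusPoint t ∈ closure (polydisc n) := by
  rw [closure_polydisc]
  exact fun i => (norm_torusPoint t i).le

theorem inter_closure_polydisc_subset_closedDomain {U : Set (Fin n → ℂ)} (hU : IsOpen U) :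
    U ∩ closure (polydisc n) ⊆ closedDomain U :=
  hU.inter_closure

theorem inter_closure_polydisc_subset_boundaryDomain (U : Set (Fin n → ℂ)) :
    U ∩ closure (polydisc n) ⊆ boundaryDomain U := fun z hz => by
  by_cases h : z ∈ polydisc n
  · exact Or.inl ⟨hz.1, h⟩
  · exact Or.inr ⟨hz.2, by rwa [(isOpen_polydisc n).interior_eq]⟩

theorem closedDomain_subset (U : Set (Fin n → ℂ)) : closedDomain U ⊆ closure (polydisc n) :=
  closure_mono inter_subset_right

theorem boundaryDomain_subset (U : Set (Fin n → ℂ)) : boundaryDomain U ⊆ closure (polydisc n) :=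
  union_subset (inter_subset_right.trans subset_closure) frontier_subset_closure

/-- The properties of the three domains that the arguments use. -/
structure IsOneSidedDomain (dom : Set (Fin n → ℂ) → Set (Fin n → ℂ)) : Prop where
  inter_polydisc_subset : ∀ U, IsOpen U → U ∩ polydisc n ⊆ dom U
  torusPoint_mem : ∀ U, IsOpen U → ∀ t, torusPoint t ∈ U → torusPoint t ∈ dom U
  subset_closure : ∀ U, dom U ⊆ closure (polydisc n)
  mono : ∀ U V, U ⊆ V → dom U ⊆ dom V

theorem isOneSidedDomain_torusDomain : IsOneSidedDomain (torusDomain (n := n)) where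
  inter_polydisc_subset _ _ := subset_union_left
  torusPoint_mem _ _ t _ := Or.inr ⟨t, rfl⟩
  subset_closure _ := union_subset (inter_subset_right.trans _root_.subset_closure) (by
    rintro _ ⟨t, rfl⟩; exact torusPoint_mem_closure_polydisc t)
  mono _ _ h := union_subset_union_left _ (inter_subset_inter_left _ h)

theorem isOneSidedDomain_closedDomain : IsOneSidedDomain (closedDomain (n := n)) where
  inter_polydisc_subset _ _ := _root_.subset_closure
  torusPoint_mem _ hU t ht :=
    inter_closure_polydisc_subset_closedDomain hU ⟨ht, torusPoint_mem_closure_polydisc t⟩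
  subset_closure := closedDomain_subset
  mono _ _ h := closure_mono (inter_subset_inter_left _ h)

theorem isOneSidedDomain_boundaryDomain : IsOneSidedDomain (boundaryDomain (n := n)) where
  inter_polydisc_subset _ _ := subset_union_left
  torusPoint_mem U _ t ht :=
    inter_closure_polydisc_subset_boundaryDomain U ⟨ht, torusPoint_mem_closure_polydisc t⟩
  subset_closure := boundaryDomain_subset
  mono _ _ h := union_subset_union_left _ (inter_subset_inter_left _ h)

theorem isOneSidedDomain_of_or {dom : Set (Fin n → ℂ) → Set (Fin n → ℂ)}
    (h : dom = torusDomain ∨ dom = closedDomain ∨ dom = boundaryDomain) : IsOneSidedDomain dom := by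
  rcases h with rfl | rfl | rfl
  · exact isOneSidedDomain_torusDomain
  · exact isOneSidedDomain_closedDomain
  · exact isOneSidedDomain_boundaryDomain

/-! ### A countable family of polycaps -/

/-- A dense sequence in the torus. -/
noncomputable def densePoint (n : ℕ) (k : ℕ) : Torus n := TopologicalSpace.denseSeq (Torus n) k

theorem closedPolycap_subset_closure_polydisc (ζ : Fin n → ℂ) (r : ℝ) :
    closedPolycap ζ r ⊆ closure (polydisc n) := by
  rw [closure_polydisc]
  exact fun z hz i => (hz i).1

/-- The radii of a basis of polycaps. -/
noncomputable def capRadius (m : ℕ) : ℝ := 1 / ((m : ℝ) + 2)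

theorem capRadius_pos (m : ℕ) : 0 < capRadius m := by unfold capRadius; positivity

theorem capRadius_le_half (m : ℕ) : capRadius m ≤ 1 / 2 := by
  unfold capRadius
  have : (0 : ℝ) ≤ m := Nat.cast_nonneg m
  gcongr
  linarith

theorem exists_capRadius_lt {ε : ℝ} (hε : 0 < ε) : ∃ m, capRadius m < ε := by
  obtain ⟨m, hm⟩ := exists_nat_one_div_lt hε
  refine ⟨m, lt_of_le_of_lt ?_ hm⟩
  unfold capRadius
  gcongr
  norm_num

/-- The polycap need not contain `ζ`: an extension near `ζ` is also one near some point of the dense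
sequence. -/
theorem exists_closedPolycap_subset {U : Set (Fin n → ℂ)} (hU : IsOpen U) {ζ : Torus n}
    (hζ : torusPoint ζ ∈ U) :
    ∃ k m, closedPolycap (torusPoint (densePoint n k)) (capRadius m) ⊆ U := by
  obtain ⟨_, hk, k, rfl⟩ := (TopologicalSpace.denseRange_denseSeq (Torus n)).inter_open_nonempty _
    (hU.preimage continuous_torusPoint) ⟨ζ, hζ⟩
  obtain ⟨δ, hδ, hball⟩ := Metric.isOpen_iff.1 hU _ hk
  obtain ⟨m, hm⟩ := exists_capRadius_lt (ε := δ ^ 2 / 2) (by positivity)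
  refine ⟨k, m, fun z hz => hball ?_⟩
  rw [mem_ball, dist_pi_lt_iff hδ]
  exact fun i => closedCap_subset_ball (norm_torusPoint _ i) hδ (by linarith) (hz i)

/-! ### Density of the functions without continuous extensions -/

/-- The diagonal circle through a point of the torus, with parameter the `j`-th coordinate. -/
noncomputable def diagonalCurve (j : Fin n) (ζ : Torus n) (t : Circle) : Torus n := fun i => t * (ζ j)⁻¹ * ζ i

theorem diagonalCurve_apply_self (j : Fin n) (ζ : Torus n) (t : Circle) :
    diagonalCurve j ζ t j = t := by simp [diagonalCurve]

variable {p : ℕ∞}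

/-- The functions that are nowhere approximable along diagonal curves. -/
def diagonalResidual (j : Fin n) (p : ℕ∞) : Set (CpTorus n p) :=
  CpTorus.nowhereApproximable n p (fun i : ℕ × ℕ => diagonalCurve j (densePoint n i.1))
    (fun i => densePoint n i.1 j) (fun i => capRadius i.2)

theorem isGδ_diagonalResidual (j : Fin n) (p : ℕ∞) : IsGδ (diagonalResidual j p) :=
  CpTorus.isGδ_nowhereApproximable _ _ _

theorem dense_diagonalResidual (j : Fin n) (p : ℕ∞) : Dense (diagonalResidual j p) :=
  CpTorus.dense_nowhereApproximable (fun _ t => diagonalCurve_apply_self j _ t) _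
    (fun _ => capRadius_pos _) fun _ => capRadius_le_half _

/-- Along the disc `ℓ` all coordinates have modulus `‖w‖`, so it passes from the open polydisc
directly to the torus. Composing with `ℓ` gives an approximation with error zero, bounded by
compactness of the cap. -/
theorem diagonalResidual_subset (j : Fin n) (p : ℕ∞) {dom : Set (Fin n → ℂ) → Set (Fin n → ℂ)}
    (hdom : IsOneSidedDomain dom) :
    diagonalResidual j p ⊆ nowhereExtendable n p dom ContinuousOn := by
  rintro f hf ζ₀ ⟨U, hU, hζ₀, F, hFc, hFd, hFf⟩
  obtain ⟨k, m, hsub⟩ := exists_closedPolycap_subset hU hζ₀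
  set ζ := densePoint n k with hζ
  set r := capRadius m with hr
  set ℓ : ℂ → Fin n → ℂ := fun w i => w * conj (ζ j : ℂ) * (ζ i : ℂ) with hℓ
  have hℓc : Continuous ℓ := by fun_prop
  have hℓd : Differentiable ℂ ℓ := by
    rw [differentiable_pi]; intro i; simp only [hℓ]; fun_prop
  have hℓnorm (w : ℂ) (i : Fin n) : ‖ℓ w i‖ = ‖w‖ := by
    simp [hℓ, Circle.norm_coe]
  have hℓconj (w : ℂ) (i : Fin n) : ℓ w i * conj (torusPoint ζ i) = w * conj (ζ j : ℂ) := by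
    have := mul_conj_self (Circle.norm_coe (ζ i))
    change w * conj (ζ j : ℂ) * (ζ i : ℂ) * conj (ζ i : ℂ) = _
    rw [mul_assoc _ (ζ i : ℂ), this, mul_one]
  have hℓmem {w : ℂ} (hw : w ∈ closedCap (ζ j) r) : ℓ w ∈ closedPolycap (torusPoint ζ) r :=
    fun i => ⟨(hℓnorm w i).trans_le hw.1, by rw [hℓconj]; exact hw.2⟩
  have hℓtorus (t : Circle) : ℓ t = torusPoint (diagonalCurve j ζ t) := by
    funext i
    simp only [hℓ, torusPoint, diagonalCurve, Circle.coe_mul, Circle.coe_inv_eq_conj]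
  have hℓdom {w : ℂ} (hw : w ∈ closedCap (ζ j) r) : ℓ w ∈ dom U := by
    have hwU := hsub (hℓmem hw)
    rcases hw.1.lt_or_eq with h1 | h1
    · exact hdom.inter_polydisc_subset U hU ⟨hwU, fun i => (hℓnorm w i).trans_lt h1⟩
    · have := hℓtorus ⟨w, mem_sphere_zero_iff_norm.2 h1⟩
      change ℓ w = _ at this
      rw [this] at hwU ⊢
      exact hdom.torusPoint_mem U hU _ hwU
  have hGc : ContinuousOn (fun w => F (ℓ w)) (closedCap (ζ j) r) :=
    hFc.comp hℓc.continuousOn fun w hw => hℓdom hw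
  obtain ⟨M, hM⟩ := (isCompact_closedCap (ζ j) r).exists_bound_of_continuousOn hGc
  obtain ⟨K, hK⟩ := exists_nat_ge M
  refine mem_iInter.1 hf ((k, m), K) fun ε hε => ⟨fun w => F (ℓ w), hGc, ?_,
    fun w hw => (hM w hw).trans hK, fun t ht => ?_⟩
  · refine hFd.comp hℓd.differentiableOn fun w hw => ?_
    exact ⟨hsub (hℓmem (openCap_subset_closedCap _ _ hw)), fun i => (hℓnorm w i).trans_lt hw.1⟩
  · have h1 := hFf (diagonalCurve j ζ t) (by rw [← hℓtorus]; exact hℓdom ht)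
    rw [← hℓtorus] at h1
    simp only
    rw [h1, sub_self, norm_zero]
    exact hε.le

end Domains

/-! ### Bounded separately continuous extensions -/

section SeparatelyContinuous

variable {n : ℕ} {p : ℕ∞}

/-- The functions that have a holomorphic extension to a polycap at `ζ` which is bounded by `M` and
separately continuous. -/
def polycapExtendable (n : ℕ) (p : ℕ∞) (ζ : Torus n) (r M : ℝ) : Set (CpTorus n p) :=
  {f | ∃ F : (Fin n → ℂ) → ℂ, HolomorphicOnPolycap F (torusPoint ζ) r M ∧
    ∀ t : Torus n, torusPoint t ∈ closedPolycap (torusPoint ζ) r → F (torusPoint t) = f.toFun t}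

/-- A point of a polycap with unimodular coordinates is a point of the torus. -/
theorem exists_torusPoint_eq {z : Fin n → ℂ} (hz : ∀ i, ‖z i‖ = 1) : ∃ t, torusPoint t = z :=
  ⟨fun i => ⟨z i, mem_sphere_zero_iff_norm.2 (hz i)⟩, rfl⟩

theorem torusPoint_mem_closedPolycap (ζ : Torus n) {r : ℝ} (hr : 0 < r) :
    torusPoint ζ ∈ closedPolycap (torusPoint ζ) r :=
  fun i => self_mem_closedCap (norm_torusPoint ζ i) hr

/-- Uniform convergence on the torus part of the polycap forces, with the common bound `M`, uniform
convergence of the extensions on the half polycap. -/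
theorem closure_polycapExtendable_subset (ζ : Torus n) {r M : ℝ} (hr : 0 < r) (hr1 : r ≤ 1) :
    closure (polycapExtendable n p ζ r M) ⊆ polycapExtendable n p ζ (r / 2) M := by
  intro f hf
  choose g hg hgf using fun k : ℕ => CpTorus.exists_mem_forall_norm_sub_le hf
    (ε := 1 / ((k : ℝ) + 1)) (by positivity)
  choose F hF hFg using hg
  set ζ' := torusPoint ζ with hζ'
  have hζn : ∀ i, ‖ζ' i‖ = 1 := norm_torusPoint ζ
  have hsub : closedPolycap ζ' (r / 2) ⊆ closedPolycap ζ' r := closedPolycap_mono _ (by linarith)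
  have hM : 0 ≤ M :=
    (norm_nonneg _).trans ((hF 0).norm_le _ (torusPoint_mem_closedPolycap ζ hr))
  -- The summand `1` keeps the bound positive when `M = 0`.
  have hdiff (k l : ℕ) : ∀ z ∈ closedPolycap ζ' (r / 2), ‖F k z - F l z‖ ≤
      twoConstantsBound n (2 * M + 1) (1 / ((k : ℝ) + 1) + 1 / ((l : ℝ) + 1)) := by
    intro z hz
    refine (((hF k).sub (hF l)).mono le_rfl (by linarith : M + M ≤ 2 * M + 1))
      |>.norm_le_twoConstantsBound hζn hr hr1 (by linarith) (by positivity) (fun z hz hz1 => ?_) hz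
    obtain ⟨t, rfl⟩ := exists_torusPoint_eq hz1
    rw [hFg k t hz, hFg l t hz]
    have := norm_sub_le ((g k).toFun t - f.toFun t) ((g l).toFun t - f.toFun t)
    rw [sub_sub_sub_cancel_right] at this
    exact this.trans (add_le_add (hgf k t) (hgf l t))
  have hcauchy : UniformCauchySeqOn F atTop (closedPolycap ζ' (r / 2)) := by
    rw [Metric.uniformCauchySeqOn_iff]
    intro ε hε
    obtain ⟨δ, hδ, hδε⟩ := Metric.eventually_nhds_iff.1
      ((tendsto_twoConstantsBound n (2 * M + 1)).eventually (gt_mem_nhds hε))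
    obtain ⟨N, hN⟩ := exists_nat_one_div_lt (half_pos hδ)
    refine ⟨N, fun k hk l hl z hz => ?_⟩
    rw [dist_eq_norm]
    refine (hdiff k l z hz).trans_lt (hδε ?_)
    have hk' : 1 / ((k : ℝ) + 1) ≤ 1 / ((N : ℝ) + 1) := Nat.one_div_le_one_div hk
    have hl' : 1 / ((l : ℝ) + 1) ≤ 1 / ((N : ℝ) + 1) := Nat.one_div_le_one_div hl
    rw [Real.dist_eq, sub_zero, abs_of_pos (by positivity)]
    linarith
  set G : (Fin n → ℂ) → ℂ := fun z => limUnder atTop fun k => F k z with hG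
  have hlim : ∀ z ∈ closedPolycap ζ' (r / 2), Tendsto (fun k => F k z) atTop (𝓝 (G z)) :=
    fun z hz => tendsto_nhds_limUnder (cauchySeq_tendsto_of_complete (hcauchy.cauchySeq hz))
  have hunif := hcauchy.tendstoUniformlyOn_of_tendsto hlim
  refine ⟨G, ⟨fun z hz => ?_, fun z hz j => ?_, ?_⟩, fun t ht => ?_⟩
  · exact le_of_tendsto (hlim z hz).norm (Eventually.of_forall fun k => (hF k).norm_le z (hsub hz))
  · have h1 : TendstoUniformlyOn (fun k w => F k (Function.update z j w))
        (fun w => G (Function.update z j w)) atTop (closedCap (ζ' j) (r / 2)) :=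
      (hunif.comp (Function.update z j)).mono fun w hw => update_mem_closedPolycap hz hw
    exact h1.continuousOn (Frequently.of_forall fun k =>
      ((hF k).continuousOn_slice z (hsub hz) j).mono (closedCap_mono _ (by linarith)))
  · exact differentiableOn_of_tendsto (isOpen_openPolycap _ _)
      (fun k => (hF k).differentiableOn.mono (openPolycap_mono _ (by linarith)))
      (fun k z hz => (hF k).norm_le z (hsub (openPolycap_subset_closedPolycap _ _ hz)))
      fun z hz => hlim z (openPolycap_subset_closedPolycap _ _ hz)
  · refine tendsto_nhds_unique (hlim _ ht) ?_
    have h1 : (fun k => F k (torusPoint t)) = fun k => (g k).toFun t :=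
      funext fun k => hFg k t (hsub ht)
    rw [h1, tendsto_iff_norm_sub_tendsto_zero]
    exact squeeze_zero (fun k => norm_nonneg _) (fun k => hgf k t)
      tendsto_one_div_add_atTop_nhds_zero_nat

/-- A whole closed polycap must lie in the domain, including the points with only some coordinates
unimodular; this is what `hdom` provides. -/
theorem exists_mem_polycapExtendable {dom : Set (Fin n → ℂ) → Set (Fin n → ℂ)}
    (hdom : ∀ U, IsOpen U → U ∩ closure (polydisc n) ⊆ dom U) {f : CpTorus n p} {ζ : Torus n}
    (hf : ExtendableAt dom BoundedSeparatelyContinuousOn f.toFun ζ) :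
    ∃ k m K : ℕ, f ∈ polycapExtendable n p (densePoint n k) (capRadius m) K := by
  obtain ⟨U, hU, hζ, F, ⟨⟨M, hM⟩, hFc⟩, hFd, hFf⟩ := hf
  obtain ⟨k, m, hsub⟩ := exists_closedPolycap_subset hU hζ
  obtain ⟨K, hK⟩ := exists_nat_ge M
  have hmem : closedPolycap (torusPoint (densePoint n k)) (capRadius m) ⊆ dom U := fun z hz =>
    hdom U hU ⟨hsub hz, closedPolycap_subset_closure_polydisc _ _ hz⟩
  refine ⟨k, m, K, F, ⟨fun z hz => (hM z (hmem hz)).trans hK, fun z hz j w hw => ?_, ?_⟩,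
    fun t ht => hFf t (hmem ht)⟩
  · have hz' := update_mem_closedPolycap hz hw
    have := hFc _ (hmem hz') j
    simp only [Function.update_idem, Function.update_self] at this
    exact this.mono fun w' hw' => hmem (update_mem_closedPolycap hz hw')
  · exact hFd.mono fun z hz => ⟨hsub (openPolycap_subset_closedPolycap _ _ hz), fun i => (hz i).1⟩

theorem exists_continuousMap_torusPoint_eq {f : Torus n → ℂ} (hf : Continuous f) :
    ∃ g : C(Fin n → ℂ, ℂ), ∀ t, g (torusPoint t) = f t := by
  have hinj : Function.Injective (torusPoint : Torus n → Fin n → ℂ) := fun s t h =>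
    funext fun i => Subtype.ext (congrFun h i)
  obtain ⟨g, hg⟩ := ContinuousMap.exists_extension
    (continuous_torusPoint.isClosedEmbedding hinj) ⟨f, hf⟩
  exact ⟨g, fun t => DFunLike.congr_fun hg t⟩

/-- A function with a bounded separately continuous extension to a polycap has such an extension to
every larger subset of the closed polydisc. -/
theorem extendableAt_of_mem_polycapExtendable {dom : Set (Fin n → ℂ) → Set (Fin n → ℂ)}
    (hdom : ∀ U, dom U ⊆ closure (polydisc n)) {f : CpTorus n p} {ζ : Torus n} {r M : ℝ}
    (hr : 0 < r) (hf : f ∈ polycapExtendable n p ζ r M) :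
    ExtendableAt dom BoundedSeparatelyContinuousOn f.toFun ζ := by
  obtain ⟨F, hF, hFf⟩ := hf
  set ζ' := torusPoint ζ with hζ'
  have hre (i : Fin n) : Continuous fun z : Fin n → ℂ => (z i * conj (ζ' i)).re := by fun_prop
  -- The depths satisfy `r / 2 < 2 r / 3 < r`: the cutoff `χ` is `1` up to the first and vanishes
  -- from the second on, before the edge of the polycap.
  set s : Set (Fin n → ℂ) := ⋃ i, {z | (z i * conj (ζ' i)).re ≤ 1 - 2 * r / 3} with hs
  set t : Set (Fin n → ℂ) := ⋂ i, {z | 1 - r / 2 ≤ (z i * conj (ζ' i)).re} with ht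
  have hsc : IsClosed s := isClosed_iUnion_of_finite fun i => isClosed_le (hre i) continuous_const
  have htc : IsClosed t := isClosed_iInter fun i => isClosed_le continuous_const (hre i)
  have hst : Disjoint s t := by
    rw [Set.disjoint_left]
    intro z hzs hzt
    obtain ⟨i, hi⟩ := mem_iUnion.1 hzs
    have h1 := mem_iInter.1 hzt i
    simp only [mem_ofPred_eq] at hi h1
    linarith
  obtain ⟨χ, hχ0, hχ1, hχI⟩ := exists_continuous_zero_one_of_isClosed hsc htc hst
  obtain ⟨g, hg⟩ := exists_continuousMap_torusPoint_eq f.continuous_toFun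
  have hcompact : IsCompact (closure (polydisc n)) := by
    rw [closure_polydisc]
    convert isCompact_univ_pi fun _ : Fin n => isCompact_closedBall (0 : ℂ) 1
    ext z; simp
  obtain ⟨M₂, hM₂⟩ := hcompact.exists_bound_of_continuousOn g.continuous.continuousOn
  -- `F` is glued to a continuous extension `g` of `f`, because `dom U` may reach beyond the
  -- polycap. On the torus part of the polycap both equal `f`, so the mixture has the right boundary
  -- values; on `U ∩ Dⁿ` it is `F`.
  set G : (Fin n → ℂ) → ℂ := fun z => (χ z : ℂ) * F z + (1 - (χ z : ℂ)) * g z with hG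
  have hGs {z : Fin n → ℂ} (hz : z ∈ s) : G z = g z := by
    have : χ z = 0 := hχ0 hz
    simp [hG, this]
  have hcases {z : Fin n → ℂ} (hz : z ∈ closure (polydisc n)) :
      (∀ i, 1 - r < (z i * conj (ζ' i)).re) ∧ z ∈ closedPolycap ζ' r ∨
        ∃ i, (z i * conj (ζ' i)).re < 1 - 2 * r / 3 := by
    rw [closure_polydisc] at hz
    by_cases h : ∀ i, 1 - r < (z i * conj (ζ' i)).re
    · exact Or.inl ⟨h, fun i => ⟨hz i, (h i).le⟩⟩
    · push Not at h
      obtain ⟨i, hi⟩ := h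
      exact Or.inr ⟨i, by linarith⟩
  set U : Set (Fin n → ℂ) := ⋂ i, {z | 1 - r / 2 < (z i * conj (ζ' i)).re} with hU
  refine ⟨U, isOpen_iInter_of_finite fun i => isOpen_lt continuous_const (hre i), ?_, G,
    ⟨⟨M + M₂, fun z hz => ?_⟩, fun z hz j => ?_⟩, ?_, fun τ hτ => ?_⟩
  · refine mem_iInter.2 fun i => ?_
    have := mul_conj_self (norm_torusPoint ζ i)
    simp only [mem_ofPred_eq]
    rw [this, Complex.one_re]
    linarith
  · have hM0 : 0 ≤ M :=
      (norm_nonneg _).trans (hF.norm_le _ (torusPoint_mem_closedPolycap ζ hr))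
    have hz' := hdom U hz
    have hgz := hM₂ z hz'
    rcases hcases hz' with ⟨-, hzp⟩ | ⟨i, hi⟩
    · have hFz := hF.norm_le z hzp
      have h0 := (hχI z).1
      have h1 := (hχI z).2
      refine (norm_add_le _ _).trans (add_le_add ?_ ?_)
      · rw [norm_mul, Complex.norm_real, Real.norm_of_nonneg h0]
        exact (mul_le_of_le_one_left (norm_nonneg _) h1).trans hFz
      · rw [norm_mul, ← Complex.ofReal_one, ← Complex.ofReal_sub, Complex.norm_real,
          Real.norm_of_nonneg (by linarith)]
        exact (mul_le_of_le_one_left (norm_nonneg _) (by linarith)).trans hgz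
    · rw [hGs (mem_iUnion.2 ⟨i, hi.le⟩)]
      linarith
  · have hup : Continuous fun w : ℂ => Function.update z j w := by fun_prop
    have hz' := hdom U hz
    refine ContinuousWithinAt.mono (t := {w | Function.update z j w ∈ closure (polydisc n)}) ?_
      fun w hw => hdom U hw
    rcases hcases hz' with ⟨hre1, hzp⟩ | ⟨i, hi⟩
    · have hFs := hF.continuousOn_slice z hzp j (z j) (hzp j)
      have hFw : ContinuousWithinAt (fun w => F (Function.update z j w))
          {w | Function.update z j w ∈ closure (polydisc n)} (z j) := by
        refine hFs.mono_of_mem_nhdsWithin ?_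
        have hopen : ∀ᶠ w in 𝓝 (z j), 1 - r < (w * conj (ζ' j)).re :=
          (by fun_prop : Continuous fun w : ℂ => (w * conj (ζ' j)).re).continuousAt.eventually
            (lt_mem_nhds (hre1 j))
        filter_upwards [self_mem_nhdsWithin, mem_nhdsWithin_of_mem_nhds hopen] with w hw hw'
        have hw1 : Function.update z j w ∈ closure (polydisc n) := hw
        rw [closure_polydisc] at hw1
        exact ⟨by simpa using hw1 j, le_of_lt hw'⟩
      have hχc : Continuous fun w : ℂ => (χ (Function.update z j w) : ℂ) :=
        Complex.continuous_ofReal.comp (χ.continuous.comp hup)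
      exact (hχc.continuousWithinAt.mul hFw).add
        ((continuous_const.sub hχc).continuousWithinAt.mul
          (g.continuous.comp hup).continuousWithinAt)
    · refine ContinuousAt.continuousWithinAt ?_
      have hev : ∀ᶠ w in 𝓝 (z j), Function.update z j w ∈ s := by
        have h1 : ContinuousAt (fun w : ℂ => (Function.update z j w i * conj (ζ' i)).re) (z j) :=
          ((hre i).comp hup).continuousAt
        have h2 : (Function.update z j (z j) i * conj (ζ' i)).re < 1 - 2 * r / 3 := by
          rwa [Function.update_eq_self]
        filter_upwards [h1.eventually (gt_mem_nhds h2)] with w hw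
        exact mem_iUnion.2 ⟨i, le_of_lt hw⟩
      refine ContinuousAt.congr (g.continuous.comp hup).continuousAt ?_
      filter_upwards [hev] with w hw
      exact (hGs hw).symm
  · refine (hF.differentiableOn.mono fun z hz i => ⟨hz.2 i, ?_⟩).congr fun z hz => ?_
    · have := mem_iInter.1 hz.1 i
      simp only [mem_ofPred_eq] at this
      linarith
    · have h1 : χ z = 1 := hχ1 (mem_iInter.2 fun i => by
        have := mem_iInter.1 hz.1 i
        simp only [mem_ofPred_eq] at this ⊢
        exact this.le)
      simp [hG, h1]
  · rcases hcases (torusPoint_mem_closure_polydisc τ) with ⟨-, hzp⟩ | ⟨i, hi⟩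
    · simp only [hG]
      rw [hFf τ hzp, hg]
      ring
    · rw [hGs (mem_iUnion.2 ⟨i, hi.le⟩), hg]

/-- Passing to closures adds no non-extendable function: a limit is still extendable to the half
polycap. -/
theorem nowhereExtendable_boundedSeparatelyContinuousOn_eq
    {dom : Set (Fin n → ℂ) → Set (Fin n → ℂ)}
    (hdom : ∀ U, IsOpen U → U ∩ closure (polydisc n) ⊆ dom U)
    (hdom' : ∀ U, dom U ⊆ closure (polydisc n)) :
    nowhereExtendable n p dom BoundedSeparatelyContinuousOn = ⋂ i : ℕ × ℕ × ℕ,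
      (closure (polycapExtendable n p (densePoint n i.1) (capRadius i.2.1) i.2.2))ᶜ := by
  ext f
  simp only [nowhereExtendable, mem_ofPred_eq, mem_iInter, mem_compl_iff]
  refine ⟨fun h i hi => h (densePoint n i.1) ?_, fun h ζ hζ => ?_⟩
  · exact extendableAt_of_mem_polycapExtendable hdom' (half_pos (capRadius_pos i.2.1))
      (closure_polycapExtendable_subset _ (capRadius_pos _)
        ((capRadius_le_half _).trans (by norm_num)) hi)
  · obtain ⟨k, m, K, hK⟩ := exists_mem_polycapExtendable hdom hζ
    exact h (k, m, K) (_root_.subset_closure hK)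

theorem isGδ_nowhereExtendable_boundedSeparatelyContinuousOn
    {dom : Set (Fin n → ℂ) → Set (Fin n → ℂ)}
    (hdom : ∀ U, IsOpen U → U ∩ closure (polydisc n) ⊆ dom U)
    (hdom' : ∀ U, dom U ⊆ closure (polydisc n)) :
    IsGδ (nowhereExtendable n p dom BoundedSeparatelyContinuousOn) := by
  rw [nowhereExtendable_boundedSeparatelyContinuousOn_eq hdom hdom']
  exact .iInter_of_isOpen fun _ => isClosed_closure.isOpen_compl

/-- Without joint continuity the diagonal disc is unavailable, so the other coordinates are frozen
on the torus and `differentiableOn_slice` gives holomorphy. -/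
theorem polycapExtendable_subset_approximable (j : Fin n) (ζ : Torus n) {r M : ℝ} (hr : 0 < r)
    (hr1 : r ≤ 1) : polycapExtendable n p ζ r M ⊆
      CpTorus.approximable n p (Function.update ζ j) (ζ j) r M := by
  rintro f ⟨F, hF, hFf⟩ ε hε
  have hζ := torusPoint_mem_closedPolycap ζ hr
  refine ⟨fun w => F (Function.update (torusPoint ζ) j w), hF.continuousOn_slice _ hζ j,
    hF.differentiableOn_slice (norm_torusPoint ζ) hr hr1 hζ j,
    fun w hw => hF.norm_le _ (update_mem_closedPolycap hζ hw), fun t ht => ?_⟩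
  have h1 : Function.update (torusPoint ζ) j (t : ℂ) = torusPoint (Function.update ζ j t) := by
    funext i
    rcases eq_or_ne i j with rfl | h
    · simp [torusPoint]
    · simp [torusPoint, h]
  have h2 := update_mem_closedPolycap hζ (j := j) (w := (t : ℂ)) ht
  simp only
  rw [h1] at h2 ⊢
  rw [hFf _ h2, sub_self, norm_zero]
  exact hε.le

theorem dense_nowhereExtendable_boundedSeparatelyContinuousOn (hn : 1 ≤ n)
    {dom : Set (Fin n → ℂ) → Set (Fin n → ℂ)}
    (hdom : ∀ U, IsOpen U → U ∩ closure (polydisc n) ⊆ dom U) :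
    Dense (nowhereExtendable n p dom BoundedSeparatelyContinuousOn) := by
  set j : Fin n := ⟨0, hn⟩
  refine (CpTorus.dense_nowhereApproximable (j := j)
    (σ := fun i : ℕ × ℕ => Function.update (densePoint n i.1) j) (fun _ t => by simp)
    (fun i => densePoint n i.1 j) (fun i => capRadius_pos i.2)
    fun i => capRadius_le_half i.2).mono fun f hf ζ hζ => ?_
  obtain ⟨k, m, K, hK⟩ := exists_mem_polycapExtendable hdom hζ
  exact mem_iInter.1 hf ((k, m), K) (polycapExtendable_subset_approximable j _ (capRadius_pos m)
    ((capRadius_le_half m).trans (by norm_num)) hK)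

end SeparatelyContinuous

/-! ### Lipschitz extensions -/

section Lipschitz

variable {n : ℕ} {p : ℕ∞}

/-- The functions with an extension to `dom U` that is Lipschitz with constant `K`. -/
def lipschitzExtendable (n : ℕ) (p : ℕ∞) (dom : Set (Fin n → ℂ) → Set (Fin n → ℂ))
    (U : Set (Fin n → ℂ)) (K : ℝ≥0) : Set (CpTorus n p) :=
  {f | ∃ F : (Fin n → ℂ) → ℂ, LipschitzOnWith K F (dom U) ∧ DifferentiableOn ℂ F (U ∩ polydisc n) ∧
    ∀ t : Torus n, torusPoint t ∈ dom U → F (torusPoint t) = f.toFun t}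

/-- A common Lipschitz constant and convergence at `ζ` bound all extensions on `dom U`. Their limit
along an ultrafilter keeps the constant and is holomorphic. -/
theorem isClosed_lipschitzExtendable {dom : Set (Fin n → ℂ) → Set (Fin n → ℂ)}
    (hdom : IsOneSidedDomain dom) {U : Set (Fin n → ℂ)} (hU : IsOpen U) {ζ : Torus n}
    (hζ : torusPoint ζ ∈ U) (K : ℝ≥0) : IsClosed (lipschitzExtendable n p dom U K) := by
  refine isClosed_of_closure_subset fun f hf => ?_
  choose g hg hgf using fun k : ℕ => CpTorus.exists_mem_forall_norm_sub_le hf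
    (ε := 1 / ((k : ℝ) + 1)) (by positivity)
  choose F hFL hFd hFg using hg
  have hζd : torusPoint ζ ∈ dom U := hdom.torusPoint_mem U hU ζ hζ
  -- `1` bounds the error `1 / (k + 1)`, and `2` the diameter of the closed polydisc in the sup
  -- norm.
  set C : ℝ := ‖f.toFun ζ‖ + 1 + K * 2 with hC
  have hbound (k : ℕ) : ∀ z ∈ dom U, ‖F k z‖ ≤ C := by
    intro z hz
    have h1 := (hFL k).dist_le_mul z hz _ hζd
    have h2 : dist z (torusPoint ζ) ≤ 2 := by
      rw [dist_pi_le_iff (by norm_num)]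
      intro i
      have hz1 := hdom.subset_closure U hz
      rw [closure_polydisc] at hz1
      rw [dist_eq_norm]
      linarith [norm_sub_le (z i) (torusPoint ζ i), hz1 i, norm_torusPoint ζ i]
    rw [dist_eq_norm, hFg k ζ hζd] at h1
    have h3 : (1 : ℝ) / ((k : ℝ) + 1) ≤ 1 := by
      rw [div_le_one (by positivity)]
      linarith [(Nat.cast_nonneg k : (0 : ℝ) ≤ k)]
    have h4 : (K : ℝ) * dist z (torusPoint ζ) ≤ K * 2 := mul_le_mul_of_nonneg_left h2 K.2
    have h5 := norm_sub_norm_le ((g k).toFun ζ) (f.toFun ζ)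
    have h6 := norm_sub_norm_le (F k z) ((g k).toFun ζ)
    linarith [hgf k ζ]
  set l : Ultrafilter ℕ := Ultrafilter.of atTop with hl
  have hex : ∀ z ∈ dom U, ∃ y, Tendsto (fun k => F k z) l (𝓝 y) := fun z hz => by
    obtain ⟨y, -, hy⟩ := (isCompact_closedBall (0 : ℂ) C).ultrafilter_le_nhds
      (l.map fun k => F k z) (by
        rw [Ultrafilter.coe_map, le_principal_iff]
        exact mem_map.2 <| Eventually.of_forall fun k => by simpa using hbound k z hz)
    exact ⟨y, hy⟩
  choose! G hG using hex
  refine ⟨G, LipschitzOnWith.of_dist_le_mul fun z hz w hw => ?_, ?_, fun t ht => ?_⟩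
  · exact le_of_tendsto ((hG z hz).dist (hG w hw))
      (Eventually.of_forall fun k => (hFL k).dist_le_mul z hz w hw)
  · have hsub := hdom.inter_polydisc_subset U hU
    exact differentiableOn_of_tendsto_ultrafilter l (hU.inter (isOpen_polydisc n)) hFd
      (fun k z hz => hbound k z (hsub hz)) fun z hz => hG z (hsub hz)
  · refine tendsto_nhds_unique (hG _ ht) ?_
    have h1 : (fun k => F k (torusPoint t)) = fun k => (g k).toFun t :=
      funext fun k => hFg k t ht
    rw [h1]
    refine Tendsto.mono_left ?_ (Ultrafilter.of_le atTop)
    rw [tendsto_iff_norm_sub_tendsto_zero]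
    exact squeeze_zero (fun k => norm_nonneg _) (fun k => hgf k t)
      tendsto_one_div_add_atTop_nhds_zero_nat

theorem isGδ_nowhereExtendable_isLipschitzOn {dom : Set (Fin n → ℂ) → Set (Fin n → ℂ)}
    (hdom : IsOneSidedDomain dom) : IsGδ (nowhereExtendable n p dom IsLipschitzOn) := by
  -- A basis set that misses the torus says nothing about extension at a torus point, so it is
  -- discarded.
  set B : Set (Set (Fin n → ℂ)) := {U ∈ TopologicalSpace.countableBasis (Fin n → ℂ) |
    ∃ ζ : Torus n, torusPoint ζ ∈ U} with hB
  have hBc : B.Countable := (TopologicalSpace.countable_countableBasis _).mono fun U hU => hU.1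
  have hBo (U : B) : IsOpen U.1 := TopologicalSpace.isOpen_of_mem_countableBasis U.2.1
  have := hBc.to_subtype
  have heq : nowhereExtendable n p dom IsLipschitzOn =
      ⋂ i : B × ℕ, (lipschitzExtendable n p dom i.1 i.2)ᶜ := by
    ext f
    simp only [mem_iInter, mem_compl_iff]
    refine ⟨fun h i hi => ?_, fun h ζ hζ => ?_⟩
    · obtain ⟨F, hFL, hFd, hFf⟩ := hi
      obtain ⟨ζ, hζ⟩ := i.1.2.2
      exact h ζ ⟨i.1, hBo i.1, hζ, F, ⟨_, hFL⟩, hFd, hFf⟩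
    · obtain ⟨U, hU, hζU, F, ⟨K, hFL⟩, hFd, hFf⟩ := hζ
      obtain ⟨V, hV, hζV, hVU⟩ :=
        (TopologicalSpace.isBasis_countableBasis (Fin n → ℂ)).exists_subset_of_mem_open hζU hU
      obtain ⟨k, hk⟩ := exists_nat_ge K
      have hmono := hdom.mono V U hVU
      exact h (⟨V, hV, ζ, hζV⟩, k) ⟨F, (hFL.mono hmono).weaken hk,
        hFd.mono (inter_subset_inter_left _ hVU), fun t ht => hFf t (hmono ht)⟩
  rw [heq]
  refine .iInter_of_isOpen fun i => ?_
  obtain ⟨ζ, hζ⟩ := i.1.2.2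
  exact (isClosed_lipschitzExtendable hdom (hBo i.1) hζ i.2).isOpen_compl

theorem nowhereExtendable_continuousOn_subset (dom : Set (Fin n → ℂ) → Set (Fin n → ℂ)) :
    nowhereExtendable n p dom ContinuousOn ⊆ nowhereExtendable n p dom IsLipschitzOn := by
  rintro f hf ζ ⟨U, hU, hζ, F, ⟨K, hK⟩, hF⟩
  exact hf ζ ⟨U, hU, hζ, F, hK.continuousOn, hF⟩

end Lipschitz

end OneSided

/-! ### The three statements assembled -/

theorem mainTheorem10 (n : ℕ) (hn : 1 ≤ n) (p : ℕ∞) :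
    (∀ dom : Set (Fin n → ℂ) → Set (Fin n → ℂ),
      dom = OneSided.closedDomain ∨ dom = OneSided.boundaryDomain →
        IsGδ (OneSided.nowhereExtendable n p dom OneSided.BoundedSeparatelyContinuousOn) ∧
        Dense (OneSided.nowhereExtendable n p dom OneSided.BoundedSeparatelyContinuousOn)) ∧
    (∀ dom : Set (Fin n → ℂ) → Set (Fin n → ℂ),
      dom = OneSided.torusDomain ∨ dom = OneSided.closedDomain ∨ dom = OneSided.boundaryDomain →
        ∃ G : Set (OneSided.CpTorus n p), IsGδ G ∧ Dense G ∧
          G ⊆ OneSided.nowhereExtendable n p dom ContinuousOn) ∧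
    (∀ dom : Set (Fin n → ℂ) → Set (Fin n → ℂ),
      dom = OneSided.torusDomain ∨ dom = OneSided.closedDomain ∨ dom = OneSided.boundaryDomain →
        IsGδ (OneSided.nowhereExtendable n p dom OneSided.IsLipschitzOn) ∧
        Dense (OneSided.nowhereExtendable n p dom OneSided.IsLipschitzOn)) := by
  refine ⟨fun dom h => ?_, fun dom h => ?_, fun dom h => ?_⟩
  · have hdom : ∀ U, IsOpen U → U ∩ closure (OneSided.polydisc n) ⊆ dom U := by
      rcases h with rfl | rfl
      · exact fun U hU => OneSided.inter_closure_polydisc_subset_closedDomain hU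
      · exact fun U _ => OneSided.inter_closure_polydisc_subset_boundaryDomain U
    exact ⟨OneSided.isGδ_nowhereExtendable_boundedSeparatelyContinuousOn hdom
      (OneSided.isOneSidedDomain_of_or (Or.inr h)).subset_closure,
      OneSided.dense_nowhereExtendable_boundedSeparatelyContinuousOn hn hdom⟩
  · exact ⟨OneSided.diagonalResidual ⟨0, hn⟩ p, OneSided.isGδ_diagonalResidual _ _,
      OneSided.dense_diagonalResidual _ _,
      OneSided.diagonalResidual_subset _ _ (OneSided.isOneSidedDomain_of_or h)⟩
  · have hdom := OneSided.isOneSidedDomain_of_or h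
    exact ⟨OneSided.isGδ_nowhereExtendable_isLipschitzOn hdom,
      (OneSided.dense_diagonalResidual ⟨0, hn⟩ p).mono
        ((OneSided.diagonalResidual_subset _ _ hdom).trans
          (OneSided.nowhereExtendable_continuousOn_subset dom))⟩
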